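/- Consider the following random graph process (version 1). It starts with a single vertex. At each step two old vertices are chosen uniformly at random, independently of each other (possibly equal) and of the past. A new vertex is added and connected to the first chosen vertex and to all neighbours of that vertex; then all edges of the second chosen vertex are deleted, except that edges of the new vertex are kept. Thus the graph is simple and has $n+1$ vertices after $n$ steps. Let $X[n,d]$ be the number of vertices of degree $d$ after $n$ steps. The local clustering coefficient of a vertex of degree $d$ is the fraction of the $\binom d2$ pairs of its neighbours that are joined by an edge (and $0$ if $d<2$); the average (Watts–Strogatz) clustering coefficient of a graph is the average of the local clustering coefficients of all its vertices; the global clustering coefficient (transitivity) is $3$ times the number of triangles divided by the number of connected triplets (paths of length $2$). Theorem. There is a (deterministic) sequence $(c_d)_{d\ge 0}$ of positive numbers with $$c_0=\frac{1+c_1}{3},\qquad c_d=\frac{d+1}{2d+3}\,(c_{d-1}+c_{d+1})\quad(d\ge 1),$$ such that, almost surely as $n\to\infty$, $X[n,d]/(n+1)\to c_d$ for every $d\ge 0$, the global clustering coefficient of the graph after $n$ steps converges to $1$, and its average clustering coefficient converges to $1-c_0-c_1$. -/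

import Mathlib

open MeasureTheory ProbabilityTheory Filter Topology

/-- Duplication: a new vertex `Fin.last (n + 1)` is added to the graph `G` on the old vertices
`Fin (n + 1)` and joined to the old vertex `a` and to all neighbours of `a`. -/
def duplicate {n : ℕ} (G : SimpleGraph (Fin (n + 1))) (a : Fin (n + 1)) :
    SimpleGraph (Fin (n + 2)) :=
  G.map Fin.castSuccEmb ⊔
    SimpleGraph.fromEdgeSet
      {e | ∃ v : Fin (n + 1), (v = a ∨ G.Adj a v) ∧ e = s(v.castSucc, Fin.last (n + 1))}

/-- One step of version 1: duplicate the old vertex `a`, then delete all edges of the old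
vertex `b`, except that edges of the new vertex are kept. -/
def stepV1 {n : ℕ} (G : SimpleGraph (Fin (n + 1))) (a b : Fin (n + 1)) :
    SimpleGraph (Fin (n + 2)) :=
  (duplicate G a).deleteEdges {e | b.castSucc ∈ e ∧ Fin.last (n + 1) ∉ e}

/-- The version 1 graph after `n` steps, started from a single vertex: in the step leading from
`n + 1` to `n + 2` vertices, `a n` is duplicated and the edges of `b n` are erased. -/
def graphV1 (a b : (n : ℕ) → Fin (n + 1)) : (n : ℕ) → SimpleGraph (Fin (n + 1))
  | 0 => ⊥
  | n + 1 => stepV1 (graphV1 a b n) (a n) (b n)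

/-- The random choices driving the model: at each step two old vertices are chosen uniformly at
random, independently of each other and of the other steps. -/
structure IsUniformSelection {Ω : Type*} [MeasurableSpace Ω] (μ : Measure Ω)
    (A B : (n : ℕ) → Ω → Fin (n + 1)) : Prop where
  measurable_fst : ∀ n, Measurable (A n)
  measurable_snd : ∀ n, Measurable (B n)
  uniform_fst : ∀ n i, μ (A n ⁻¹' {i}) = ((n : ENNReal) + 1)⁻¹
  uniform_snd : ∀ n i, μ (B n ⁻¹' {i}) = ((n : ENNReal) + 1)⁻¹
  indep_pair : ∀ n, IndepFun (A n) (B n) μ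
  indep_steps : iIndepFun (fun n ω => (A n ω, B n ω)) μ

section Graph

open scoped Classical

/-- The number of vertices of degree `d`. -/
noncomputable def degreeCount {V : Type*} [Fintype V] (G : SimpleGraph V) (d : ℕ) : ℕ :=
  (Finset.univ.filter fun v => G.degree v = d).card

/-- The local clustering coefficient: the fraction of the pairs of neighbours of `v` that are
joined by an edge, and `0` if `v` has degree less than `2`. -/
noncomputable def localClustering {V : Type*} [Fintype V] (G : SimpleGraph V) (v : V) : ℝ :=
  if G.degree v < 2 then 0
  else ((G.induce (G.neighborSet v)).edgeFinset.card : ℝ) / ((G.degree v).choose 2 : ℝ)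

/-- The average (Watts–Strogatz) clustering coefficient. -/
noncomputable def averageClustering {V : Type*} [Fintype V] (G : SimpleGraph V) : ℝ :=
  (∑ v, localClustering G v) / (Fintype.card V : ℝ)

/-- The connected triplets (paths of length 2), each given by its central vertex and the
unordered pair of its two endpoints. -/
noncomputable def connectedTriplets {V : Type*} [Fintype V] (G : SimpleGraph V) :
    Finset ((_ : V) × Finset V) :=
  Finset.univ.sigma fun v => (G.neighborFinset v).powersetCard 2

/-- The global clustering coefficient (transitivity): three times the number of triangles divided
by the number of connected triplets. -/
noncomputable def globalClustering {V : Type*} [Fintype V] (G : SimpleGraph V) : ℝ :=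
  3 * ((G.cliqueFinset 3).card : ℝ) / ((connectedTriplets G).card : ℝ)

end Graph

/-!
A vertex of degree `k` gains a neighbour at rate `k + 1` by duplication, loses one at rate `k` by
deletion, and is itself copied (with degree `k + 1`) and deleted (to degree `0`) at rate `1`. In
expectation the degree counts therefore follow the forward equation of a birth and death process
with birth rates `k + 2` and death rates `k`, with an extra source at `0`, whose generator acts on
counts as `d ↦ (d + 1) (x (d - 1) - 2 x d + x (d + 1))`. The normalised counts `x n` thus obey the
stochastic approximation scheme `x (n + 1) d = x n d + (n + 2)⁻¹ (δ₀ d + (d + 1) Δ (x n) d - x n d)`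
up to errors: martingale differences, and an interaction term from the vertices affected by both the
duplication and the deletion. Both are controlled by the second moment `∑ v, (deg v + 1) ^ 2`, whose
expectation is `O(n)`, so the series of the errors converges almost surely. A fixed point of the
scheme is the law of the birth and death process at an independent exponential time. The error `y`
with respect to it satisfies the homogeneous scheme, whence `Δ (limsup |y|) ≥ 0`; a bounded
subharmonic sequence with Dirichlet boundary that is nonnegative at `0` vanishes, so `y → 0`.

For the clustering coefficients, count the open triplets. Those through the deleted vertex disappear
and those through the duplicated vertex are copied, so that in expectation their number grows
only when the two vertices are equal or adjacent, by `O(∑ v, (deg v + 1) ^ 2 / n ^ 2)`. Divided by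
the number of vertices it is an almost supermartingale whose expectation tends to `0`, hence it
tends to `0` almost surely, while the number of vertices of degree `2` grows linearly.
-/

open scoped BigOperators

/-! ### The limiting degree distribution -/

/-- The sequence `x` moved one place to the right, with boundary value `0`. -/
def shiftRight (x : ℕ → ℝ) : ℕ → ℝ
  | 0 => 0
  | d + 1 => x d

/-- The discrete Laplacian on `ℕ` with an absorbing (Dirichlet) boundary point at `-1`. -/
def dirichletLaplacian : (ℕ → ℝ) →ₗ[ℝ] ℕ → ℝ where
  toFun x d := shiftRight x d - 2 * x d + x (d + 1)
  map_add' x y := by ext (_ | d) <;> simp only [shiftRight, Pi.add_apply] <;> ring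
  map_smul' r x := by
    ext (_ | d) <;> simp only [shiftRight, Pi.smul_apply, smul_eq_mul, RingHom.id_apply] <;> ring

lemma dirichletLaplacian_apply (x : ℕ → ℝ) (d : ℕ) :
    dirichletLaplacian x d = shiftRight x d - 2 * x d + x (d + 1) := rfl

lemma eq_zero_of_bounded_subharmonic {x : ℕ → ℝ} (h0 : 0 ≤ x 0) (hbdd : BddAbove (Set.range x))
    (hsub : ∀ d, 0 ≤ dirichletLaplacian x d) : x = 0 := by
  set δ : ℕ → ℝ := fun d => x d - shiftRight x d with hδ
  have hδmono : Monotone δ := monotone_nat_of_le_succ fun d => by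
    have := hsub d
    rw [dirichletLaplacian_apply] at this
    change x d - shiftRight x d ≤ x (d + 1) - x d
    linarith
  have hδ0 (d : ℕ) : 0 ≤ δ d := le_trans (by simpa [hδ, shiftRight] using h0) (hδmono d.zero_le)
  have hmono : Monotone x := monotone_nat_of_le_succ fun d => sub_nonneg.1 (hδ0 (d + 1))
  have hlim := tendsto_atTop_ciSup hmono hbdd
  have hδlim : Tendsto δ atTop (𝓝 0) := (tendsto_add_atTop_iff_nat 1).1 <| by
    simpa [hδ, shiftRight] using (hlim.comp (tendsto_add_atTop_nat 1)).sub hlim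
  have hδeq (d : ℕ) : δ d = 0 := le_antisymm (hδmono.ge_of_tendsto hδlim d) (hδ0 d)
  ext d
  induction d with
  | zero => simpa [hδ, shiftRight] using hδeq 0
  | succ d ih => simpa [hδ, shiftRight, ih] using hδeq (d + 1)

/-- The probability that the birth and death process started from `0`, with birth rate `k + 2` and
death rate `k` in state `k`, is in state `d` at time `t`. -/
noncomputable def birthDeathLaw (d : ℕ) (t : ℝ) : ℝ := ((d : ℝ) + 1) * t ^ d / (1 + t) ^ (d + 2)

/-- The limiting degree distribution: the law of the birth and death process of `birthDeathLaw` at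
an independent exponential time. -/
noncomputable def limitDegree (d : ℕ) : ℝ :=
  ∫ t in Set.Ioi (0 : ℝ), Real.exp (-t) * birthDeathLaw d t

lemma birthDeathLaw_pos (d : ℕ) {t : ℝ} (ht : 0 < t) : 0 < birthDeathLaw d t := by
  unfold birthDeathLaw; positivity

lemma birthDeathLaw_le_one (d : ℕ) {t : ℝ} (ht : 0 < t) : birthDeathLaw d t ≤ 1 := by
  rw [birthDeathLaw, div_le_one (by positivity)]
  calc ((d : ℝ) + 1) * t ^ d
      = t ^ d * 1 ^ (d + 1 - d) * (d + 1).choose d := by simp [mul_comm]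
    _ ≤ ∑ k ∈ Finset.range (d + 1 + 1), t ^ k * 1 ^ (d + 1 - k) * (d + 1).choose k :=
        Finset.single_le_sum (f := fun k => t ^ k * 1 ^ (d + 1 - k) * ((d + 1).choose k : ℝ))
          (fun k _ => by positivity) (Finset.mem_range.2 (by omega))
    _ = (1 + t) ^ (d + 1) := by rw [← add_pow, add_comm]
    _ ≤ (1 + t) ^ (d + 2) := pow_le_pow_right₀ (by linarith) (by omega)

lemma birthDeathLaw_zero_right (d : ℕ) : birthDeathLaw d 0 = if d = 0 then 1 else 0 := by
  rcases d with _ | d <;> simp [birthDeathLaw]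

/-- Kolmogorov's forward equation. -/
lemma hasDerivAt_birthDeathLaw (d : ℕ) {t : ℝ} (ht : 0 ≤ t) :
    HasDerivAt (birthDeathLaw d)
      (((d : ℝ) + 1) * dirichletLaplacian (fun k => birthDeathLaw k t) d) t := by
  have h0 : 1 + t ≠ 0 := by positivity
  have h := (((hasDerivAt_id t).pow d).const_mul ((d : ℝ) + 1)).div
    (((hasDerivAt_id t).const_add 1).pow (d + 2)) (pow_ne_zero _ h0)
  refine HasDerivAt.congr_deriv (f := birthDeathLaw d) h ?_
  rcases d with _ | d <;>
    simp [dirichletLaplacian_apply, shiftRight, birthDeathLaw] <;> field_simp <;> ring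

lemma integrableOn_exp_neg_mul_birthDeathLaw (d : ℕ) :
    IntegrableOn (fun t : ℝ => Real.exp (-t) * birthDeathLaw d t) (Set.Ioi 0) := by
  refine (integrableOn_exp_neg_Ioi 0).mono' ?_ ?_
  · refine ContinuousOn.aestronglyMeasurable (fun t ht => ?_) measurableSet_Ioi
    exact ((by fun_prop : Continuous fun t : ℝ => Real.exp (-t)).continuousAt.mul
      (hasDerivAt_birthDeathLaw d (le_of_lt ht)).continuousAt).continuousWithinAt
  · refine (ae_restrict_iff' measurableSet_Ioi).2 (ae_of_all _ fun t ht => ?_)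
    rw [Real.norm_of_nonneg (mul_pos (Real.exp_pos _) (birthDeathLaw_pos d ht)).le]
    exact mul_le_of_le_one_right (Real.exp_pos _).le (birthDeathLaw_le_one d ht)

lemma limitDegree_pos (d : ℕ) : 0 < limitDegree d := by
  have hpos : ∀ t ∈ Set.Ioi (0 : ℝ), 0 < Real.exp (-t) * birthDeathLaw d t := fun t ht =>
    mul_pos (Real.exp_pos _) (birthDeathLaw_pos d ht)
  rw [limitDegree, setIntegral_pos_iff_support_of_nonneg_ae
    ((ae_restrict_iff' measurableSet_Ioi).2 (ae_of_all _ fun t ht => (hpos t ht).le))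
    (integrableOn_exp_neg_mul_birthDeathLaw d)]
  exact lt_of_lt_of_le (by simp) (measure_mono fun t ht => ⟨(hpos t ht).ne', ht⟩)

lemma limitDegree_le_one (d : ℕ) : limitDegree d ≤ 1 := by
  simpa only [integral_exp_neg_Ioi_zero, limitDegree] using
    setIntegral_mono_on (integrableOn_exp_neg_mul_birthDeathLaw d) (integrableOn_exp_neg_Ioi 0)
      measurableSet_Ioi fun t ht =>
        mul_le_of_le_one_right (Real.exp_pos (-t)).le (birthDeathLaw_le_one d ht)

lemma integrableOn_exp_neg_mul_shiftRight (d : ℕ) :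
    IntegrableOn (fun t => Real.exp (-t) * shiftRight (fun k => birthDeathLaw k t) d)
      (Set.Ioi 0) := by
  rcases d with _ | d
  · simp [shiftRight]
  · exact integrableOn_exp_neg_mul_birthDeathLaw d

lemma integral_exp_neg_mul_shiftRight (d : ℕ) :
    ∫ t in Set.Ioi (0 : ℝ), Real.exp (-t) * shiftRight (fun k => birthDeathLaw k t) d =
      shiftRight limitDegree d := by
  rcases d with _ | d <;> simp [shiftRight, limitDegree]

lemma integrableOn_exp_neg_mul_dirichletLaplacian (d : ℕ) :
    IntegrableOn (fun t => Real.exp (-t) * dirichletLaplacian (fun k => birthDeathLaw k t) d)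
      (Set.Ioi 0) := by
  simp only [dirichletLaplacian_apply, mul_add, mul_sub, mul_left_comm _ (2 : ℝ)]
  exact ((integrableOn_exp_neg_mul_shiftRight d).sub
    ((integrableOn_exp_neg_mul_birthDeathLaw d).const_mul 2)).add
      (integrableOn_exp_neg_mul_birthDeathLaw (d + 1))

lemma integral_exp_neg_mul_dirichletLaplacian (d : ℕ) :
    ∫ t in Set.Ioi (0 : ℝ), Real.exp (-t) * dirichletLaplacian (fun k => birthDeathLaw k t) d =
      dirichletLaplacian limitDegree d := by
  have hs := integrableOn_exp_neg_mul_shiftRight d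
  have hd := (integrableOn_exp_neg_mul_birthDeathLaw d).const_mul 2
  have hd' := integrableOn_exp_neg_mul_birthDeathLaw (d + 1)
  simp only [dirichletLaplacian_apply, mul_add, mul_sub, mul_left_comm _ (2 : ℝ)]
  rw [integral_add (by exact hs.sub hd) hd', integral_sub hs hd, integral_exp_neg_mul_shiftRight,
    integral_const_mul]
  rfl

/-- The resolvent equation, by integrating Kolmogorov's equation by parts against `exp (-t)`. -/
lemma limitDegree_eq_ite_add_dirichletLaplacian (d : ℕ) :
    limitDegree d =
      (if d = 0 then 1 else 0) + ((d : ℝ) + 1) * dirichletLaplacian limitDegree d := by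
  have hint := integrableOn_exp_neg_mul_dirichletLaplacian d
  have hderiv : ∀ t ∈ Set.Ici (0 : ℝ), HasDerivAt (fun t => -(Real.exp (-t) * birthDeathLaw d t))
      (Real.exp (-t) * birthDeathLaw d t - ((d : ℝ) + 1) *
        (Real.exp (-t) * dirichletLaplacian (fun k => birthDeathLaw k t) d)) t := fun t ht =>
    (((hasDerivAt_neg t).exp.mul (hasDerivAt_birthDeathLaw d ht)).neg).congr_deriv (by ring)
  have hlim : Tendsto (fun t => -(Real.exp (-t) * birthDeathLaw d t)) atTop (𝓝 0) := by
    rw [← neg_zero]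
    refine Tendsto.neg (squeeze_zero' ?_ ?_ Real.tendsto_exp_neg_atTop_nhds_zero)
    · filter_upwards [eventually_gt_atTop 0] with t ht
      exact (mul_pos (Real.exp_pos _) (birthDeathLaw_pos d ht)).le
    · filter_upwards [eventually_gt_atTop 0] with t ht
      exact mul_le_of_le_one_right (Real.exp_pos _).le (birthDeathLaw_le_one d ht)
  have h := integral_Ioi_of_hasDerivAt_of_tendsto' hderiv
    ((integrableOn_exp_neg_mul_birthDeathLaw d).sub (hint.const_mul _)) hlim
  rw [integral_sub (integrableOn_exp_neg_mul_birthDeathLaw d) (hint.const_mul _),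
    integral_const_mul, integral_exp_neg_mul_dirichletLaplacian, ← limitDegree,
    birthDeathLaw_zero_right] at h
  simp only [neg_zero, Real.exp_zero, one_mul, sub_neg_eq_add, zero_add] at h
  linarith

lemma limitDegree_zero : limitDegree 0 = (1 + limitDegree 1) / 3 := by
  have h := limitDegree_eq_ite_add_dirichletLaplacian 0
  simp only [dirichletLaplacian_apply, shiftRight, if_true, Nat.cast_zero, zero_add] at h
  linarith

lemma limitDegree_eq_mul_add {d : ℕ} (hd : 1 ≤ d) : limitDegree d =
    ((d : ℝ) + 1) / (2 * d + 3) * (limitDegree (d - 1) + limitDegree (d + 1)) := by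
  obtain ⟨k, rfl⟩ := Nat.exists_eq_add_of_le' hd
  have h := limitDegree_eq_ite_add_dirichletLaplacian (k + 1)
  rw [dirichletLaplacian_apply, shiftRight, if_neg k.succ_ne_zero] at h
  rw [Nat.add_sub_cancel]
  field_simp
  linear_combination h

/-! ### Stochastic approximation -/

section StochasticApproximation

variable {s : ℕ → ℝ}

lemma eventually_le_add_of_contraction {w : ℕ → ℝ} {η : ℝ}
    (hs : ∀ᶠ n in atTop, s n ≤ 1)
    (hsum : Tendsto (fun n => ∑ k ∈ Finset.range n, s k) atTop atTop)
    (hw : ∀ᶠ n in atTop, w (n + 1) ≤ (1 - s n) * w n + s n * η) {ε : ℝ} (hε : 0 < ε) :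
    ∀ᶠ n in atTop, w n ≤ η + ε := by
  obtain ⟨m, hm⟩ := eventually_atTop.1 (hs.and hw)
  set p : ℕ → ℝ := fun n => max (w n - η) 0
  have hp (n : ℕ) (hn : n ≥ m) : p (n + 1) ≤ (1 - s n) * p n + 0 := by
    obtain ⟨hsn, hwn⟩ := hm n hn
    have hsn' := sub_nonneg.2 hsn
    refine (max_le ?_ (mul_nonneg hsn' (le_max_right _ _))).trans_eq (add_zero _).symm
    linarith [mul_le_mul_of_nonneg_left (le_max_left (w n - η) 0) hsn']
  have hbound (n : ℕ) (hn : m ≤ n) : p n ≤ p m * Real.exp (-∑ k ∈ Finset.Ico m n, s k) := by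
    have h := discrete_gronwall_prod_general hp (fun n hn => sub_nonneg.2 (hm n hn).1) hn
    simp only [zero_mul, Finset.sum_const_zero, add_zero] at h
    refine h.trans (mul_le_mul_of_nonneg_left ?_ (le_max_right _ _))
    rw [← Finset.sum_neg_distrib, Real.exp_sum]
    exact Finset.prod_le_prod (fun k hk => sub_nonneg.2 (hm k (Finset.mem_Ico.1 hk).1).1)
      fun k _ => Real.one_sub_le_exp_neg _
  have hlim : Tendsto (fun n => p m * Real.exp (-∑ k ∈ Finset.Ico m n, s k)) atTop (𝓝 0) := by
    rw [← mul_zero (p m)]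
    refine (Real.tendsto_exp_neg_atTop_nhds_zero.comp ?_).const_mul _
    refine (tendsto_atTop_add_const_right _ (-∑ k ∈ Finset.range m, s k) hsum).congr' ?_
    filter_upwards [eventually_ge_atTop m] with n hn
    rw [Finset.sum_Ico_eq_sub _ hn, sub_eq_add_neg]
  filter_upwards [eventually_ge_atTop m, hlim.eventually_le_const hε] with n hn hnε
  linarith [(le_max_left (w n - η) 0).trans ((hbound n hn).trans hnε)]

lemma eventually_le_limsup_add {u : ℕ → ℝ} {K : ℝ} (hu : ∀ n, u n ≤ K) {ε : ℝ} (hε : 0 < ε) :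
    ∀ᶠ n in atTop, u n ≤ limsup u atTop + ε :=
  (eventually_lt_of_limsup_lt (lt_add_of_pos_right _ hε) (isBoundedUnder_of ⟨K, hu⟩)).mono
    fun _ hn => hn.le

variable (hs0 : ∀ n, 0 ≤ s n) (hs : Tendsto s atTop (𝓝 0))
  (hsum : Tendsto (fun n => ∑ k ∈ Finset.range n, s k) atTop atTop)

include hs0 hs hsum

lemma eventually_abs_le_add_of_recursion {y g e : ℕ → ℝ} {κ γ l : ℝ} (hκ : 0 < κ)
    (hy : ∀ n, y (n + 1) = y n + s n * (g n - κ * y n) + e n)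
    (he : Tendsto (fun n => ∑ k ∈ Finset.range n, e k) atTop (𝓝 l))
    (hg : ∀ ε > 0, ∀ᶠ n in atTop, |g n| ≤ γ + ε) {ε : ℝ} (hε : 0 < ε) :
    ∀ᶠ n in atTop, |y n| ≤ γ / κ + ε := by
  -- Adding the tail of the noise series to `y` removes the noise from the recursion.
  set τ : ℕ → ℝ := fun n => l - ∑ k ∈ Finset.range n, e k
  have hτ {δ : ℝ} (hδ : 0 < δ) : ∀ᶠ n in atTop, |τ n| ≤ δ := by
    have h : Tendsto τ atTop (𝓝 0) := by simpa using he.const_sub l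
    exact h.abs.eventually_le_const (by simpa using hδ)
  have hκs : ∀ᶠ n in atTop, κ * s n ≤ 1 :=
    (hs.const_mul κ).eventually_le_const (by simp)
  have hcontr : ∀ᶠ n in atTop, |y (n + 1) + τ (n + 1)| ≤
      (1 - κ * s n) * |y n + τ n| + κ * s n * (γ / κ + ε / 3) := by
    filter_upwards [hg (κ * (ε / 6)) (by positivity), hτ (by positivity : 0 < ε / 6), hκs]
      with n hgn hτn hκn
    have hstep : y (n + 1) + τ (n + 1) =
        (1 - κ * s n) * (y n + τ n) + s n * (g n + κ * τ n) := by
      simp only [hy, τ, Finset.sum_range_succ]; ring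
    have hdrift : |g n + κ * τ n| ≤ κ * (γ / κ + ε / 3) :=
      calc |g n + κ * τ n| ≤ |g n| + κ * |τ n| := by
            simpa only [abs_mul, abs_of_pos hκ] using abs_add_le (g n) (κ * τ n)
        _ ≤ (γ + κ * (ε / 6)) + κ * (ε / 6) := by gcongr
        _ = κ * (γ / κ + ε / 3) := by field_simp; ring
    calc |y (n + 1) + τ (n + 1)|
        ≤ |(1 - κ * s n) * (y n + τ n)| + |s n * (g n + κ * τ n)| := hstep ▸ abs_add_le _ _
      _ = (1 - κ * s n) * |y n + τ n| + s n * |g n + κ * τ n| := by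
          rw [abs_mul, abs_mul, abs_of_nonneg (hs0 n), abs_of_nonneg (sub_nonneg.2 hκn)]
      _ ≤ (1 - κ * s n) * |y n + τ n| + s n * (κ * (γ / κ + ε / 3)) := by
          gcongr; exact hs0 n
      _ = _ := by ring
  have hsum' : Tendsto (fun n => ∑ k ∈ Finset.range n, κ * s k) atTop atTop := by
    simpa only [Finset.mul_sum] using hsum.const_mul_atTop hκ
  filter_upwards [eventually_le_add_of_contraction (w := fun n => |y n + τ n|) hκs hsum' hcontr
    (by positivity : 0 < ε / 3), hτ (by positivity : 0 < ε / 3)] with n hyτ hτn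
  have := abs_sub (y n + τ n) (τ n)
  rw [add_sub_cancel_right] at this
  linarith

section Coupled

variable {y e : ℕ → ℕ → ℝ} {α : ℕ → ℝ} {K : ℝ} (hα : ∀ d, 0 < α d) (hK : ∀ n d, |y n d| ≤ K)
  (he : ∀ d, ∃ l, Tendsto (fun n => ∑ k ∈ Finset.range n, e k d) atTop (𝓝 l))
  (hy : ∀ n d, y (n + 1) d = y n d + s n * (α d * dirichletLaplacian (y n) d - y n d) + e n d)

include hα hK he hy

lemma dirichletLaplacian_limsup_nonneg_of_recursion (d : ℕ) :
    0 ≤ dirichletLaplacian (fun k => limsup (fun n => |y n k|) atTop) d := by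
  set L : ℕ → ℝ := fun k => limsup (fun n => |y n k|) atTop
  have hev (k : ℕ) {ε : ℝ} (hε : 0 < ε) : ∀ᶠ n in atTop, |y n k| ≤ L k + ε :=
    eventually_le_limsup_add (fun n => hK n k) hε
  have hev_shift {ε : ℝ} (hε : 0 < ε) :
      ∀ᶠ n in atTop, |shiftRight (y n) d| ≤ shiftRight L d + ε := by
    rcases d with _ | d
    · exact .of_forall fun n => by simpa [shiftRight] using hε.le
    · exact hev d hε
  have hαd := hα d
  obtain ⟨l, hl⟩ := he d
  have hLd : L d ≤ α d * (shiftRight L d + L (d + 1)) / (2 * α d + 1) := by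
    refine le_of_forall_pos_le_add fun ε hε => limsup_le_of_le
      (isBoundedUnder_of ⟨0, fun n => abs_nonneg _⟩).isCoboundedUnder_le ?_
    refine eventually_abs_le_add_of_recursion hs0 hs hsum (by positivity)
      (g := fun n => α d * (shiftRight (y n) d + y n (d + 1))) (fun n => ?_) hl (fun δ hδ => ?_) hε
    · rw [hy, dirichletLaplacian_apply]; ring
    · filter_upwards [hev_shift (by positivity : 0 < δ / (2 * α d)),
        hev (d + 1) (by positivity : 0 < δ / (2 * α d))] with n hn hn'
      rw [abs_mul, abs_of_pos hαd]
      calc α d * |shiftRight (y n) d + y n (d + 1)|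
          ≤ α d * ((shiftRight L d + δ / (2 * α d)) + (L (d + 1) + δ / (2 * α d))) := by
            gcongr; exact (abs_add_le _ _).trans (add_le_add hn hn')
        _ = α d * (shiftRight L d + L (d + 1)) + δ := by field_simp; ring
  have hLd0 : 0 ≤ L d := le_limsup_of_frequently_le (.of_forall fun n => abs_nonneg _)
    (isBoundedUnder_of ⟨K, fun n => hK n d⟩)
  rw [le_div_iff₀ (by positivity)] at hLd
  refine (mul_nonneg_iff_of_pos_left hαd).1 ?_
  rw [dirichletLaplacian_apply]
  linarith

lemma tendsto_zero_of_laplacian_recursion (d : ℕ) : Tendsto (fun n => y n d) atTop (𝓝 0) := by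
  set L : ℕ → ℝ := fun k => limsup (fun n => |y n k|) atTop
  have hL0 : 0 ≤ L 0 := le_limsup_of_frequently_le (.of_forall fun n => abs_nonneg _)
    (isBoundedUnder_of ⟨K, fun n => hK n 0⟩)
  have hLK (k : ℕ) : L k ≤ K := limsup_le_of_le
    (isBoundedUnder_of ⟨0, fun n => abs_nonneg _⟩).isCoboundedUnder_le (.of_forall fun n => hK n k)
  have hL : L = 0 := eq_zero_of_bounded_subharmonic hL0 ⟨K, Set.forall_mem_range.2 hLK⟩
    (dirichletLaplacian_limsup_nonneg_of_recursion hs0 hs hsum hα hK he hy)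
  refine squeeze_zero_norm' (a := fun n => |y n d|) (.of_forall fun n => le_rfl) ?_
  refine tendsto_of_le_liminf_of_limsup_le ?_ (congrFun hL d).le
    (isBoundedUnder_of ⟨K, fun n => hK n d⟩) (isBoundedUnder_of ⟨0, fun n => abs_nonneg _⟩)
  exact le_liminf_of_le (isBoundedUnder_of ⟨K, fun n => hK n d⟩).isCoboundedUnder_ge
    (.of_forall fun n => abs_nonneg _)

end Coupled

end StochasticApproximation

/-! ### Almost sure convergence -/

section Probability

variable {Ω : Type*} {m mΩ : MeasurableSpace Ω} {μ : Measure Ω}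

lemma ae_summable_of_summable_integral {f : ℕ → Ω → ℝ} (hf : ∀ n, Integrable (f n) μ)
    (h0 : ∀ n, 0 ≤ f n) (hs : Summable fun n => ∫ ω, f n ω ∂μ) :
    ∀ᵐ ω ∂μ, Summable fun n => f n ω := by
  have hfin : ∫⁻ ω, ∑' n, ENNReal.ofReal (f n ω) ∂μ ≠ ⊤ := by
    rw [lintegral_tsum fun n => (hf n).aemeasurable.ennreal_ofReal]
    simp_rw [← ofReal_integral_eq_lintegral_ofReal (hf _) (ae_of_all _ (h0 _))]
    rw [← ENNReal.ofReal_tsum_of_nonneg (fun n => integral_nonneg (h0 n)) hs]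
    exact ENNReal.ofReal_ne_top
  filter_upwards [ae_lt_top' (AEMeasurable.tsum fun n =>
    (hf n).aemeasurable.ennreal_ofReal) hfin] with ω hω
  simpa only [ENNReal.toReal_ofReal (h0 _ ω)] using ENNReal.summable_toReal hω.ne

lemma condExp_comp_of_indep [IsFiniteMeasure μ] {S : Type*} [Fintype S] [MeasurableSpace S]
    [MeasurableSingletonClass S] {X : Ω → S} (hX : Measurable X) (hm : m ≤ mΩ)
    (hXm : Indep (MeasurableSpace.comap X inferInstance) m μ) {f : S → Ω → ℝ}
    (hfm : ∀ s, StronglyMeasurable[m] (f s)) (hfi : ∀ s, Integrable (f s) μ) :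
    μ[fun ω => f (X ω) ω | m] =ᵐ[μ] fun ω => ∑ s, μ.real (X ⁻¹' {s}) * f s ω := by
  set I : S → Ω → ℝ := fun s => (X ⁻¹' {s}).indicator 1
  have hXs (s : S) : MeasurableSet[MeasurableSpace.comap X inferInstance] (X ⁻¹' {s}) :=
    ⟨{s}, measurableSet_singleton s, rfl⟩
  have hXs' (s : S) : MeasurableSet (X ⁻¹' {s}) := hX.comap_le _ (hXs s)
  have hint (s : S) : Integrable (f s * I s) μ := by
    classical
    refine ((hfi s).indicator (hXs' s)).congr (ae_of_all _ fun ω => ?_)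
    simp [I, Set.indicator_apply]
  have hterm (s : S) : μ[f s * I s | m] =ᵐ[μ] fun ω => μ.real (X ⁻¹' {s}) * f s ω := by
    filter_upwards [condExp_mul_of_stronglyMeasurable_left (hfm s) (hint s)
      ((integrable_const (1 : ℝ)).indicator (hXs' s)),
      condExp_indep_eq hX.comap_le hm (f := I s) (stronglyMeasurable_one.indicator (hXs s)) hXm]
      with ω hmul hindep
    rw [hmul, Pi.mul_apply, hindep, integral_indicator_one (hXs' s), mul_comm]
  have hsum : (fun ω => f (X ω) ω) = ∑ s, f s * I s := by
    classical
    ext ω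
    simp [I, Set.indicator_apply]
  rw [hsum]
  filter_upwards [condExp_finsetSum (fun s _ => hint s) m, ae_all_iff.2 hterm] with ω hadd hs
  rw [hadd, Finset.sum_apply]
  exact Finset.sum_congr rfl fun s _ => hs s

lemma integral_mul_eq_zero_of_condExp_eq_zero (hm : m ≤ mΩ) [SigmaFinite (μ.trim hm)]
    {f g : Ω → ℝ} (hf : StronglyMeasurable[m] f) (hg : Integrable g μ)
    (hfg : Integrable (f * g) μ) (h0 : μ[g | m] =ᵐ[μ] 0) : ∫ ω, (f * g) ω ∂μ = 0 := by
  rw [← integral_condExp hm]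
  refine integral_eq_zero_of_ae ?_
  filter_upwards [condExp_mul_of_stronglyMeasurable_left hf hfg hg, h0] with ω hmul hω
  simp [hmul, hω]

variable [IsFiniteMeasure μ] {F : Filtration ℕ mΩ}

lemma ae_exists_tendsto_of_submartingale {f : ℕ → Ω → ℝ} (hf : Submartingale f F μ) {R : ℝ}
    (hR : ∀ n, ∫ ω, |f n ω| ∂μ ≤ R) :
    ∀ᵐ ω ∂μ, ∃ l, Tendsto (fun n => f n ω) atTop (𝓝 l) := by
  refine hf.exists_ae_tendsto_of_bdd (R := R.toNNReal) fun n => ?_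
  rw [eLpNorm_one_eq_lintegral_enorm, ← ofReal_integral_norm_eq_lintegral_enorm (hf.integrable n)]
  exact ENNReal.ofReal_le_ofReal (hR n)

section MartingaleDifferences

variable {ζ : ℕ → Ω → ℝ} (hmeas : ∀ k, StronglyMeasurable[F (k + 1)] (ζ k))
  (hL2 : ∀ k, MemLp (ζ k) 2 μ) (hζ : ∀ k, μ[ζ k | F k] =ᵐ[μ] 0)

omit [IsFiniteMeasure μ] in
include hmeas in
lemma stronglyMeasurable_sum_range (n : ℕ) :
    StronglyMeasurable[F n] fun ω => ∑ k ∈ Finset.range n, ζ k ω :=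
  Finset.stronglyMeasurable_fun_sum _ fun k hk =>
    (hmeas k).mono (F.mono (Nat.succ_le_of_lt (Finset.mem_range.1 hk)))

include hmeas hL2 hζ

lemma martingale_sum_range : Martingale (fun n ω => ∑ k ∈ Finset.range n, ζ k ω) F μ := by
  have hζi (k : ℕ) : Integrable (ζ k) μ := (hL2 k).integrable one_le_two
  have hi (n : ℕ) : Integrable (fun ω => ∑ k ∈ Finset.range n, ζ k ω) μ :=
    integrable_finsetSum _ fun k _ => hζi k
  have hm := stronglyMeasurable_sum_range hmeas
  refine martingale_nat hm hi fun n => ?_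
  simp_rw [Finset.sum_range_succ]
  filter_upwards [condExp_add (hi n) (hζi n) (F n), hζ n] with ω hadd hω
  have := congrFun (condExp_of_stronglyMeasurable (F.le n) (hm n) (hi n)) ω
  rw [Pi.zero_apply] at hω
  rw [Pi.add_apply, this, hω, add_zero] at hadd
  exact hadd.symm

lemma integral_sq_sum_range (n : ℕ) :
    ∫ ω, (∑ k ∈ Finset.range n, ζ k ω) ^ 2 ∂μ =
      ∑ k ∈ Finset.range n, ∫ ω, ζ k ω ^ 2 ∂μ := by
  induction n with
  | zero => simp
  | succ n ih =>
    set M : Ω → ℝ := fun ω => ∑ k ∈ Finset.range n, ζ k ω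
    have hM : MemLp M 2 μ := memLp_finsetSum _ fun k _ => hL2 k
    have hcross : ∫ ω, (M * ζ n) ω ∂μ = 0 :=
      integral_mul_eq_zero_of_condExp_eq_zero (F.le n) (stronglyMeasurable_sum_range hmeas n)
        ((hL2 n).integrable one_le_two) (hM.integrable_mul (hL2 n)) (hζ n)
    calc ∫ ω, (∑ k ∈ Finset.range (n + 1), ζ k ω) ^ 2 ∂μ
        = ∫ ω, (M ω ^ 2 + 2 * (M * ζ n) ω + ζ n ω ^ 2) ∂μ := by
          congr with ω
          rw [Finset.sum_range_succ, add_sq, Pi.mul_apply, mul_assoc]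
      _ = ∫ ω, M ω ^ 2 ∂μ + 2 * ∫ ω, (M * ζ n) ω ∂μ + ∫ ω, ζ n ω ^ 2 ∂μ := by
          have hMζ := (hM.integrable_mul (hL2 n)).const_mul 2
          rw [integral_add (by exact hM.integrable_sq.add hMζ) (hL2 n).integrable_sq,
            integral_add hM.integrable_sq hMζ, integral_const_mul]
      _ = _ := by rw [hcross, ih, Finset.sum_range_succ, mul_zero, add_zero]

lemma ae_exists_tendsto_sum_martingaleDifference (hs : Summable fun k => ∫ ω, ζ k ω ^ 2 ∂μ) :
    ∀ᵐ ω ∂μ, ∃ l, Tendsto (fun n => ∑ k ∈ Finset.range n, ζ k ω) atTop (𝓝 l) := by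
  have hmart := martingale_sum_range hmeas hL2 hζ
  refine ae_exists_tendsto_of_submartingale hmart.submartingale
    (R := μ.real Set.univ + ∑' k, ∫ ω, ζ k ω ^ 2 ∂μ) fun n => ?_
  have hsq : Integrable (fun ω => (∑ k ∈ Finset.range n, ζ k ω) ^ 2) μ :=
    (memLp_finsetSum _ fun k _ => hL2 k).integrable_sq
  calc ∫ ω, |∑ k ∈ Finset.range n, ζ k ω| ∂μ
      ≤ ∫ ω, (1 + (∑ k ∈ Finset.range n, ζ k ω) ^ 2) ∂μ := by
        refine integral_mono (hmart.integrable n).abs ((integrable_const 1).add hsq) fun ω => ?_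
        set x := ∑ k ∈ Finset.range n, ζ k ω
        linarith [sq_nonneg (|x| - 1), sq_abs x, sq_nonneg x]
    _ = μ.real Set.univ + ∑ k ∈ Finset.range n, ∫ ω, ζ k ω ^ 2 ∂μ := by
        rw [integral_add (integrable_const 1) hsq, integral_sq_sum_range hmeas hL2 hζ]
        simp
    _ ≤ _ := by
        gcongr
        exact hs.sum_le_tsum _ fun k _ => integral_nonneg fun ω => sq_nonneg _

end MartingaleDifferences

section AlmostSupermartingale

variable {Y e : ℕ → Ω → ℝ} (hYm : ∀ n, StronglyMeasurable[F n] (Y n))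
  (hem : ∀ n, StronglyMeasurable[F n] (e n)) (hYi : ∀ n, Integrable (Y n) μ)
  (hei : ∀ n, Integrable (e n) μ) (hY0 : ∀ n, 0 ≤ Y n) (he0 : ∀ n, 0 ≤ e n)
  (hY : ∀ n, μ[Y (n + 1) | F n] ≤ᵐ[μ] Y n + e n) (hes : Summable fun n => ∫ ω, e n ω ∂μ)

include hYi hei hY in
lemma integral_le_add_sum_of_condExp_le (n : ℕ) :
    ∫ ω, Y n ω ∂μ ≤ ∫ ω, Y 0 ω ∂μ + ∑ k ∈ Finset.range n, ∫ ω, e k ω ∂μ := by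
  induction n with
  | zero => simp
  | succ n ih =>
    calc ∫ ω, Y (n + 1) ω ∂μ = ∫ ω, (μ[Y (n + 1) | F n]) ω ∂μ := (integral_condExp (F.le n)).symm
      _ ≤ ∫ ω, (Y n + e n) ω ∂μ :=
          integral_mono_ae integrable_condExp ((hYi n).add (hei n)) (hY n)
      _ = ∫ ω, Y n ω ∂μ + ∫ ω, e n ω ∂μ := integral_add (hYi n) (hei n)
      _ ≤ _ := by rw [Finset.sum_range_succ]; linarith

include hYm hem hYi hei hY in
lemma supermartingale_sub_sum_range :
    Supermartingale (fun n => Y n - fun ω => ∑ k ∈ Finset.range n, e k ω) F μ := by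
  set S : ℕ → Ω → ℝ := fun n ω => ∑ k ∈ Finset.range n, e k ω
  have hSm (n : ℕ) {l : ℕ} (hl : n ≤ l + 1) : StronglyMeasurable[F l] (S n) :=
    Finset.stronglyMeasurable_fun_sum _ fun k hk =>
      (hem k).mono (F.mono (by have := Finset.mem_range.1 hk; omega))
  have hSi (n : ℕ) : Integrable (S n) μ := integrable_finsetSum _ fun k _ => hei k
  refine supermartingale_nat (fun n => (hYm n).sub (hSm n n.le_succ))
    (fun n => (hYi n).sub (hSi n)) fun n => ?_
  filter_upwards [condExp_sub (hYi (n + 1)) (hSi (n + 1)) (F n), hY n] with ω hsub hle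
  rw [hsub, Pi.sub_apply, condExp_of_stronglyMeasurable (F.le n) (hSm _ le_rfl) (hSi (n + 1))]
  simp only [Pi.sub_apply, Pi.add_apply, S, Finset.sum_range_succ] at hle ⊢
  linarith

include hYm hem hYi hei hY0 he0 hY hes

/-- The Robbins–Siegmund theorem without multiplicative error. -/
lemma ae_exists_tendsto_of_almost_supermartingale :
    ∀ᵐ ω ∂μ, ∃ l, Tendsto (fun n => Y n ω) atTop (𝓝 l) := by
  set S : ℕ → Ω → ℝ := fun n ω => ∑ k ∈ Finset.range n, e k ω
  have hSi (n : ℕ) : Integrable (S n) μ := integrable_finsetSum _ fun k _ => hei k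
  have hS0 (n : ℕ) (ω : Ω) : 0 ≤ S n ω := Finset.sum_nonneg fun k _ => he0 k ω
  have hsuper := supermartingale_sub_sum_range hYm hem hYi hei hY
  have hbound (n : ℕ) : ∫ ω, |(-(fun n => Y n - S n)) n ω| ∂μ ≤
      ∫ ω, Y 0 ω ∂μ + 2 * ∑' k, ∫ ω, e k ω ∂μ := by
    calc ∫ ω, |(-(fun n => Y n - S n)) n ω| ∂μ ≤ ∫ ω, (Y n ω + S n ω) ∂μ := by
          refine integral_mono ((hYi n).sub (hSi n)).neg.abs ((hYi n).add (hSi n)) fun ω => ?_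
          have hYω : 0 ≤ Y n ω := hY0 n ω
          have := hS0 n ω
          simp only [Pi.neg_apply, Pi.sub_apply, abs_neg]
          exact abs_le.2 ⟨by linarith, by linarith⟩
      _ = ∫ ω, Y n ω ∂μ + ∑ k ∈ Finset.range n, ∫ ω, e k ω ∂μ := by
          rw [integral_add (hYi n) (hSi n), integral_finsetSum _ fun k _ => hei k]
      _ ≤ _ := by
          linarith [integral_le_add_sum_of_condExp_le hYi hei hY n,
            hes.sum_le_tsum (Finset.range n) fun k _ => integral_nonneg (he0 k)]
  filter_upwards [ae_exists_tendsto_of_submartingale hsuper.neg hbound,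
    ae_summable_of_summable_integral hei he0 hes] with ω ⟨l, hl⟩ hsum
  exact ⟨_, by simpa [S] using hl.neg.add hsum.hasSum.tendsto_sum_nat⟩

lemma ae_tendsto_zero_of_almost_supermartingale
    (hlim : Tendsto (fun n => ∫ ω, Y n ω ∂μ) atTop (𝓝 0)) :
    ∀ᵐ ω ∂μ, Tendsto (fun n => Y n ω) atTop (𝓝 0) := by
  have hL1 : Tendsto (fun n => eLpNorm (Y n - 0) 1 μ) atTop (𝓝 0) := by
    have h := (ENNReal.continuous_ofReal.tendsto 0).comp hlim
    rw [ENNReal.ofReal_zero] at h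
    refine h.congr fun n => ?_
    rw [sub_zero, eLpNorm_one_eq_lintegral_enorm, Function.comp_apply,
      ofReal_integral_eq_lintegral_ofReal (hYi n) (ae_of_all _ (hY0 n))]
    exact lintegral_congr fun ω => (Real.enorm_of_nonneg (hY0 n ω)).symm
  obtain ⟨u, hu, hYu⟩ := (tendstoInMeasure_of_tendsto_eLpNorm one_ne_zero
    (fun n => (hYi n).aestronglyMeasurable) aestronglyMeasurable_zero hL1).exists_seq_tendsto_ae
  filter_upwards [ae_exists_tendsto_of_almost_supermartingale hYm hem hYi hei hY0 he0 hY hes, hYu]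
    with ω ⟨l, hl⟩ hω
  rwa [tendsto_nhds_unique (hl.comp hu.tendsto_atTop) hω] at hl

end AlmostSupermartingale

end Probability

/-! ### Degree statistics of one step -/

lemma expect_prod {α β : Type*} [Fintype α] [Fintype β] (f : α × β → ℝ) :
    𝔼 p, f p = 𝔼 a, 𝔼 b, f (a, b) := by
  rw [← Finset.univ_product_univ, Finset.expect_product]

section ClosedNeighbourhood

open scoped Classical

variable {V : Type*} (G : SimpleGraph V) (v w : V)

/-- The indicator matrix of the closed neighbourhoods of `G`. -/
noncomputable def closedAdjMatrix : Matrix V V ℝ := 1 + G.adjMatrix ℝ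

lemma closedAdjMatrix_apply :
    closedAdjMatrix G v w = if v = w ∨ G.Adj v w then 1 else 0 := by
  rcases eq_or_ne v w with rfl | h
  · simp [closedAdjMatrix]
  · simp [closedAdjMatrix, h]

lemma closedAdjMatrix_comm : closedAdjMatrix G v w = closedAdjMatrix G w v := by
  simp only [closedAdjMatrix_apply, G.adj_comm, eq_comm]

lemma closedAdjMatrix_nonneg : 0 ≤ closedAdjMatrix G v w := by
  rw [closedAdjMatrix_apply]; positivity

lemma adjMatrix_nonneg : 0 ≤ G.adjMatrix ℝ v w := by
  rw [SimpleGraph.adjMatrix_apply]; positivity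

lemma adjMatrix_add_ite : G.adjMatrix ℝ v w + (if v = w then 1 else 0) = closedAdjMatrix G v w := by
  rw [closedAdjMatrix, Matrix.add_apply, Matrix.one_apply, add_comm]

variable [Fintype V]

lemma sum_adjMatrix : ∑ w, G.adjMatrix ℝ v w = G.degree v := by
  simp only [SimpleGraph.adjMatrix_apply, G.degree_eq_sum_if_adj]

lemma sum_closedAdjMatrix : ∑ w, closedAdjMatrix G v w = G.degree v + 1 := by
  simp only [← adjMatrix_add_ite, Finset.sum_add_distrib, sum_adjMatrix, Finset.sum_ite_eq,
    Finset.mem_univ, if_true]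

end ClosedNeighbourhood

section Step

open scoped Classical

variable {n : ℕ} (G : SimpleGraph (Fin (n + 1))) (a b v w : Fin (n + 1))

lemma duplicate_adj_castSucc : (duplicate G a).Adj v.castSucc w.castSucc ↔ G.Adj v w := by
  have hlast (x : Fin (n + 1)) : x.castSucc ≠ Fin.last (n + 1) := Fin.castSucc_ne_last x
  simp only [duplicate, SimpleGraph.sup_adj, SimpleGraph.fromEdgeSet_adj]
  refine ⟨?_, fun h => .inl ((SimpleGraph.map_adj_apply (f := Fin.castSuccEmb)).2 h)⟩
  rintro (h | ⟨⟨x, -, hx⟩, -⟩)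
  · exact (SimpleGraph.map_adj_apply (f := Fin.castSuccEmb) (a := v) (b := w)).1 h
  · simp [hlast] at hx

lemma duplicate_adj_last :
    (duplicate G a).Adj (Fin.last (n + 1)) w.castSucc ↔ w = a ∨ G.Adj a w := by
  have hlast (x : Fin (n + 1)) : x.castSucc ≠ Fin.last (n + 1) := Fin.castSucc_ne_last x
  simp only [duplicate, SimpleGraph.sup_adj, SimpleGraph.fromEdgeSet_adj]
  refine ⟨?_, fun h => .inr ⟨⟨w, h, Sym2.eq_swap⟩, (hlast w).symm⟩⟩
  rintro (h | ⟨⟨x, hx, hwx⟩, -⟩)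
  · obtain ⟨x, y, -, hx, -⟩ := (SimpleGraph.map_adj _ _ _ _).1 h
    exact absurd hx (hlast x)
  · obtain rfl : w = x := by simpa [hlast, (hlast _).symm] using hwx
    exact hx

lemma stepV1_adj_castSucc : (stepV1 G a b).Adj v.castSucc w.castSucc ↔
    G.Adj v w ∧ v ≠ b ∧ w ≠ b := by
  rw [stepV1, SimpleGraph.deleteEdges_adj, duplicate_adj_castSucc]
  simp [eq_comm (a := b), (Fin.castSucc_ne_last _).symm]

lemma stepV1_adj_last :
    (stepV1 G a b).Adj (Fin.last (n + 1)) w.castSucc ↔ w = a ∨ G.Adj a w := by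
  rw [stepV1, SimpleGraph.deleteEdges_adj, duplicate_adj_last]
  simp

lemma degree_stepV1_last : (stepV1 G a b).degree (Fin.last (n + 1)) = G.degree a + 1 := by
  rw [← Nat.cast_inj (R := ℝ), Nat.cast_add_one, ← sum_adjMatrix, ← sum_closedAdjMatrix,
    Fin.sum_univ_castSucc]
  simp [SimpleGraph.adjMatrix_apply, stepV1_adj_last, closedAdjMatrix_apply, eq_comm (a := a)]

lemma degree_stepV1_castSucc : (stepV1 G a b).degree v.castSucc =
    (if v = b then 0 else G.degree v - if G.Adj v b then 1 else 0) +
      if v = a ∨ G.Adj v a then 1 else 0 := by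
  have herase : (Finset.univ.filter fun w => G.Adj v w ∧ w ≠ b).card =
      G.degree v - if G.Adj v b then 1 else 0 := by
    have : (Finset.univ.filter fun w => G.Adj v w ∧ w ≠ b) = (G.neighborFinset v).erase b := by
      ext w; simp [and_comm]
    rw [this, Finset.card_erase_eq_ite]
    simp only [SimpleGraph.mem_neighborFinset, G.card_neighborFinset_eq_degree]
    split_ifs <;> rfl
  rw [← herase, ← SimpleGraph.card_neighborFinset_eq_degree, SimpleGraph.neighborFinset_eq_filter,
    Finset.card_filter, Fin.sum_univ_castSucc, Finset.card_filter]
  simp only [stepV1_adj_castSucc, SimpleGraph.adj_comm _ _ (Fin.last _), stepV1_adj_last,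
    G.adj_comm a]
  by_cases hvb : v = b <;> simp [hvb]

end Step

section DegreeStatistic

open scoped Classical

variable (f : ℕ → ℝ) {V : Type*} [Fintype V]

/-- The additive functional of the degree sequence that weights a vertex of degree `k` by `f k`. -/
noncomputable def degreeStatistic (G : SimpleGraph V) : ℝ := ∑ v, f (G.degree v)

lemma degreeStatistic_nonneg {f : ℕ → ℝ} (hf : 0 ≤ f) (G : SimpleGraph V) :
    0 ≤ degreeStatistic f G :=
  Finset.sum_nonneg fun v _ => hf (G.degree v)

lemma degreeStatistic_bot : degreeStatistic f (⊥ : SimpleGraph V) = Fintype.card V * f 0 := by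
  simp [degreeStatistic, SimpleGraph.degree]

/-- The generator of the birth and death process of `birthDeathLaw`. -/
def birthDeathGenerator (k : ℕ) : ℝ :=
  (k + 2) * (f (k + 1) - f k) + k * (f (k - 1) - f k)

lemma birthDeathGenerator_add_one : birthDeathGenerator (fun k => (k : ℝ) + 1) = 2 := by
  ext (_ | k) <;> simp only [birthDeathGenerator, Pi.ofNat_apply] <;> push_cast <;> ring

lemma birthDeathGenerator_add_one_sq :
    birthDeathGenerator (fun k => ((k : ℝ) + 1) ^ 2) = fun k : ℕ => 6 * ((k : ℝ) + 1) := by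
  ext (_ | k) <;> simp only [birthDeathGenerator] <;> push_cast <;> ring

/-- The increment of `degreeStatistic f` in a step with selected vertices `p`, to first order: the
duplication of `p.1` and the deletion at `p.2` act as if they did not interact. -/
noncomputable def linearIncrement (G : SimpleGraph V) (p : V × V) : ℝ :=
  ∑ v, closedAdjMatrix G v p.1 * (f (G.degree v + 1) - f (G.degree v)) +
    ∑ v, G.adjMatrix ℝ v p.2 * (f (G.degree v - 1) - f (G.degree v)) +
    (f (G.degree p.1 + 1) - f (G.degree p.2) + f 0)

/-- The correction to `linearIncrement`, from the vertices that are affected both by the duplication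
of `p.1` and by the deletion at `p.2`. -/
noncomputable def interaction (G : SimpleGraph V) (p : V × V) : ℝ :=
  ∑ v, closedAdjMatrix G v p.1 *
    (G.adjMatrix ℝ v p.2 * (f (G.degree v + 1) - 2 * f (G.degree v) + f (G.degree v - 1)) +
      if v = p.2 then f (G.degree v + 1) - f (G.degree v) - (f 1 - f 0) else 0)

lemma apply_degree_stepV1_castSucc {n : ℕ} (G : SimpleGraph (Fin (n + 1))) (a b v : Fin (n + 1)) :
    f ((stepV1 G a b).degree v.castSucc) = f (G.degree v) +
      closedAdjMatrix G v a * (f (G.degree v + 1) - f (G.degree v)) +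
      G.adjMatrix ℝ v b * (f (G.degree v - 1) - f (G.degree v)) +
      (if v = b then f 0 - f (G.degree v) else 0) -
      closedAdjMatrix G v a *
        (G.adjMatrix ℝ v b * (f (G.degree v + 1) - 2 * f (G.degree v) + f (G.degree v - 1)) +
          if v = b then f (G.degree v + 1) - f (G.degree v) - (f 1 - f 0) else 0) := by
  have hpos : G.Adj v b → G.degree v - 1 + 1 = G.degree v := fun h =>
    Nat.sub_add_cancel ((G.degree_pos_iff_exists_adj v).2 ⟨b, h⟩)
  rw [degree_stepV1_castSucc, closedAdjMatrix_apply, SimpleGraph.adjMatrix_apply]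
  rcases eq_or_ne v b with rfl | hvb
  · by_cases hva : v = a ∨ G.Adj v a
    · simp only [if_pos hva, SimpleGraph.irrefl, if_true, if_false, zero_add]
      ring
    · simp [hva]
  · by_cases hva : v = a ∨ G.Adj v a <;> by_cases hadj : G.Adj v b
    · simp only [if_pos hva, if_pos hadj, if_neg hvb, hpos hadj]
      ring
    all_goals simp [hva, hadj, hvb]

lemma degreeStatistic_stepV1 {n : ℕ} (G : SimpleGraph (Fin (n + 1))) (a b : Fin (n + 1)) :
    degreeStatistic f (stepV1 G a b) =
      degreeStatistic f G + linearIncrement f G (a, b) - interaction f G (a, b) := by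
  have hold : ∑ v : Fin (n + 1), f ((stepV1 G a b).degree v.castSucc) =
      degreeStatistic f G +
        ∑ v, closedAdjMatrix G v a * (f (G.degree v + 1) - f (G.degree v)) +
        ∑ v, G.adjMatrix ℝ v b * (f (G.degree v - 1) - f (G.degree v)) +
        (f 0 - f (G.degree b)) - interaction f G (a, b) := by
    simp only [apply_degree_stepV1_castSucc, Finset.sum_add_distrib, Finset.sum_sub_distrib,
      Finset.sum_ite_eq', Finset.mem_univ, if_true, interaction, degreeStatistic]
    congr!
  rw [degreeStatistic, Fin.sum_univ_castSucc, degree_stepV1_last, hold, linearIncrement]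
  ring

lemma interaction_nonneg (hf : Monotone fun k => f (k + 1) - f k) (G : SimpleGraph V)
    (p : V × V) : 0 ≤ interaction f G p := by
  refine Finset.sum_nonneg fun v _ => mul_nonneg (closedAdjMatrix_nonneg G v _)
    (add_nonneg ?_ ?_)
  · rw [SimpleGraph.adjMatrix_apply]
    split_ifs with h
    · obtain ⟨k, hk⟩ := Nat.exists_eq_add_of_lt ((G.degree_pos_iff_exists_adj v).2 ⟨_, h⟩)
      have := hf k.le_succ
      simp only [hk, zero_add, Nat.add_sub_cancel, Nat.succ_eq_add_one] at this ⊢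
      linarith
    · simp
  · split_ifs
    · exact sub_nonneg.2 (hf (G.degree v).zero_le)
    · rfl

section Indicator

variable (d : ℕ) (G : SimpleGraph V)

lemma degreeCount_eq_degreeStatistic :
    (degreeCount G d : ℝ) = degreeStatistic (fun k => if k = d then 1 else 0) G := by
  rw [degreeCount, degreeStatistic, Finset.sum_boole]

lemma birthDeathGenerator_ite (k : ℕ) :
    birthDeathGenerator (fun k => if k = d then 1 else 0) k =
      (d + 1) * dirichletLaplacian (fun j => if k = j then 1 else 0) d := by
  have hshift : (d + 1 : ℝ) * shiftRight (fun j => if k = j then 1 else 0) d =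
      (k + 2) * if k + 1 = d then 1 else 0 := by
    cases d with
    | zero => simp [shiftRight]
    | succ d =>
      simp only [shiftRight, add_left_inj]
      split_ifs with h
      · rw [h]; push_cast; ring
      · simp
  have hpred : (k : ℝ) * (if k - 1 = d then 1 else 0) = (d + 1) * if k = d + 1 then 1 else 0 := by
    cases k with
    | zero => simp
    | succ k =>
      simp only [Nat.add_sub_cancel, add_left_inj]
      split_ifs with h
      · rw [h]; push_cast; ring
      · simp
  have hself : (k : ℝ) * (if k = d then 1 else 0) = d * if k = d then 1 else 0 := by
    split_ifs with h
    · rw [h]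
    · simp
  rw [birthDeathGenerator, dirichletLaplacian_apply]
  linear_combination hpred - hshift - 2 * hself

lemma degreeStatistic_birthDeathGenerator_ite :
    degreeStatistic (birthDeathGenerator fun k => if k = d then 1 else 0) G =
      (d + 1) * dirichletLaplacian (fun j => (degreeCount G j : ℝ)) d := by
  have hsum : (fun j => (degreeCount G j : ℝ)) =
      ∑ v, fun j => if G.degree v = j then (1 : ℝ) else 0 := by
    ext j
    rw [degreeCount_eq_degreeStatistic, degreeStatistic, Finset.sum_apply]
  simp only [degreeStatistic, birthDeathGenerator_ite, ← Finset.mul_sum, hsum, map_sum,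
    Finset.sum_apply]

end Indicator

section Bounded

variable {f} (hf : ∀ k, f k ∈ Set.Icc 0 1) (G : SimpleGraph V) (p : V × V)
include hf

lemma abs_linearIncrement_le :
    |linearIncrement f G p| ≤ (G.degree p.1 + 1) + (G.degree p.2 + 1) + 1 := by
  have hsum {c : V → ℝ} (hc : ∀ v, 0 ≤ c v) (φ : V → ℕ) :
      |∑ v, c v * (f (φ v) - f (G.degree v))| ≤ ∑ v, c v := by
    refine (Finset.abs_sum_le_sum_abs _ _).trans (Finset.sum_le_sum fun v _ => ?_)
    rw [abs_mul, abs_of_nonneg (hc v)]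
    exact mul_le_of_le_one_right (hc v) (Real.dist_le_of_mem_Icc_01 (hf _) (hf _))
  have hdup := hsum (fun v => closedAdjMatrix_nonneg G v p.1) fun v => G.degree v + 1
  have hdel := hsum (fun v => adjMatrix_nonneg G v p.2) fun v => G.degree v - 1
  rw [Finset.sum_congr rfl fun v _ => closedAdjMatrix_comm G v p.1, sum_closedAdjMatrix] at hdup
  rw [Finset.sum_congr rfl fun v _ => G.isSymm_adjMatrix.apply p.2 v, sum_adjMatrix] at hdel
  have hself := abs_sub_le_iff.1 <|
    Real.dist_le_of_mem_Icc_01 (hf (G.degree p.1 + 1)) (hf (G.degree p.2))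
  have h0 := hf 0
  rw [abs_le] at hdup hdel ⊢
  rw [linearIncrement]
  constructor <;> linarith [hdup.1, hdup.2, hdel.1, hdel.2, hself.1, hself.2, h0.1, h0.2]

lemma abs_interaction_le : |interaction f G p| ≤
    2 * ∑ v, closedAdjMatrix G v p.1 * closedAdjMatrix G v p.2 := by
  rw [Finset.mul_sum]
  refine (Finset.abs_sum_le_sum_abs _ _).trans (Finset.sum_le_sum fun v _ => ?_)
  rw [abs_mul, abs_of_nonneg (closedAdjMatrix_nonneg G v _), mul_left_comm 2]
  refine mul_le_mul_of_nonneg_left ?_ (closedAdjMatrix_nonneg G v _)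
  have h1 := abs_sub_le_iff.1 (Real.dist_le_of_mem_Icc_01 (hf (G.degree v + 1)) (hf (G.degree v)))
  have h2 := abs_sub_le_iff.1 (Real.dist_le_of_mem_Icc_01 (hf (G.degree v)) (hf (G.degree v - 1)))
  have h3 := abs_sub_le_iff.1 (Real.dist_le_of_mem_Icc_01 (hf 1) (hf 0))
  rw [← adjMatrix_add_ite, SimpleGraph.adjMatrix_apply]
  rcases eq_or_ne v p.2 with hv | hv
  · rw [hv, if_neg (G.irrefl), if_pos rfl, if_pos rfl, ← hv, abs_le]
    constructor <;> linarith
  · rw [if_neg hv, if_neg hv, abs_le]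
    split_ifs <;> constructor <;> linarith

end Bounded

section Average

variable (G : SimpleGraph V)

lemma expect_closedAdjMatrix (v : V) :
    𝔼 a, closedAdjMatrix G v a = (G.degree v + 1) / Fintype.card V := by
  rw [Fintype.expect_eq_sum_div_card, sum_closedAdjMatrix]

lemma expect_adjMatrix (v : V) : 𝔼 b, G.adjMatrix ℝ v b = G.degree v / Fintype.card V := by
  rw [Fintype.expect_eq_sum_div_card, sum_adjMatrix]

lemma expect_sum_closedAdjMatrix_mul :
    𝔼 p : V × V, ∑ v, closedAdjMatrix G v p.1 * closedAdjMatrix G v p.2 =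
      degreeStatistic (fun k => ((k : ℝ) + 1) ^ 2) G / (Fintype.card V : ℝ) ^ 2 := by
  rw [Finset.expect_sum_comm, degreeStatistic, Finset.sum_div]
  refine Finset.sum_congr rfl fun v _ => ?_
  simp only [expect_prod, ← Finset.expect_mul_expect, expect_closedAdjMatrix]
  ring

lemma expect_abs_interaction_le (hf : ∀ k, f k ∈ Set.Icc 0 1) :
    𝔼 p, |interaction f G p| ≤
      2 * degreeStatistic (fun k => ((k : ℝ) + 1) ^ 2) G / (Fintype.card V : ℝ) ^ 2 := by
  rw [mul_div_assoc, ← expect_sum_closedAdjMatrix_mul, Finset.mul_expect]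
  exact Finset.expect_le_expect fun p _ => abs_interaction_le hf G p

variable [Nonempty V]

lemma expect_linearIncrement : 𝔼 p, linearIncrement f G p =
    degreeStatistic (birthDeathGenerator f) G / Fintype.card V + f 0 := by
  let g (a : V) := ∑ v, closedAdjMatrix G v a * (f (G.degree v + 1) - f (G.degree v)) +
    f (G.degree a + 1)
  let h (b : V) := ∑ v, G.adjMatrix ℝ v b * (f (G.degree v - 1) - f (G.degree v)) -
    f (G.degree b) + f 0
  have hsplit (p : V × V) : linearIncrement f G p = g p.1 + h p.2 := by
    rw [linearIncrement]; ring
  simp only [hsplit, expect_prod, Finset.expect_add_distrib, Fintype.expect_const]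
  simp only [g, h, Finset.expect_add_distrib, Finset.expect_sub_distrib, Finset.expect_sum_comm,
    ← Finset.expect_mul, expect_closedAdjMatrix, expect_adjMatrix, Fintype.expect_const]
  simp only [Fintype.expect_eq_sum_div_card, Finset.sum_div, degreeStatistic]
  rw [← add_assoc, add_left_inj, ← Finset.sum_sub_distrib, ← Finset.sum_add_distrib,
    ← Finset.sum_add_distrib]
  refine Finset.sum_congr rfl fun v _ => ?_
  rw [birthDeathGenerator]
  ring

lemma expect_degreeStatistic_stepV1_le
    (hf : Monotone fun k => f (k + 1) - f k) {n : ℕ} (G : SimpleGraph (Fin (n + 1))) :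
    𝔼 p : Fin (n + 1) × Fin (n + 1), degreeStatistic f (stepV1 G p.1 p.2) ≤
      degreeStatistic f G + degreeStatistic (birthDeathGenerator f) G / (n + 1) + f 0 := by
  calc 𝔼 p : Fin (n + 1) × Fin (n + 1), degreeStatistic f (stepV1 G p.1 p.2)
      ≤ 𝔼 p, (degreeStatistic f G + linearIncrement f G p) :=
        Finset.expect_le_expect fun p _ => by
          rw [degreeStatistic_stepV1]
          exact sub_le_self _ (interaction_nonneg f hf G p)
    _ = _ := by
        rw [Finset.expect_add_distrib, Fintype.expect_const, expect_linearIncrement,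
          Fintype.card_fin, Nat.cast_add_one, add_assoc]

lemma expect_linearIncrement_sq_le (hf : ∀ k, f k ∈ Set.Icc 0 1) :
    𝔼 p, linearIncrement f G p ^ 2 ≤
    9 * degreeStatistic (fun k => ((k : ℝ) + 1) ^ 2) G / Fintype.card V := by
  let x (a : V) : ℝ := G.degree a + 1
  have hx (a : V) : 1 ≤ x a := le_add_of_nonneg_left (Nat.cast_nonneg _)
  have hone : 1 ≤ 𝔼 a, x a ^ 2 :=
    Finset.le_expect Finset.univ_nonempty fun a _ => one_le_pow₀ (hx a)
  calc 𝔼 p, linearIncrement f G p ^ 2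
      ≤ 𝔼 p : V × V, 3 * (x p.1 ^ 2 + x p.2 ^ 2 + 1) := by
        refine Finset.expect_le_expect fun p _ => ?_
        have h : |linearIncrement f G p| ≤ x p.1 + x p.2 + 1 := abs_linearIncrement_le hf G p
        nlinarith [sq_le_sq' (neg_le_of_abs_le h) (le_of_abs_le h), sq_nonneg (x p.1 - x p.2),
          sq_nonneg (x p.1 - 1), sq_nonneg (x p.2 - 1)]
    _ = 3 * (2 * 𝔼 a, x a ^ 2 + 1) := by
        simp only [expect_prod, ← Finset.mul_expect, Finset.expect_add_distrib, two_mul,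
          Fintype.expect_const]
    _ ≤ 9 * 𝔼 a, x a ^ 2 := by linarith
    _ = _ := by rw [Fintype.expect_eq_sum_div_card, mul_div_assoc, degreeStatistic]

end Average

end DegreeStatistic

/-! ### Open triplets -/

section OpenTriplets

open scoped Classical

section General

variable {V : Type*} (G : SimpleGraph V)

/-- The indicator that `v` is the centre, and `x`, `y` are the endpoints, of an open triplet: a path
of length 2 whose endpoints are not joined. -/
noncomputable def openInd (v x y : V) : ℝ :=
  if G.Adj v x ∧ G.Adj v y ∧ x ≠ y ∧ ¬ G.Adj x y then 1 else 0

lemma openInd_nonneg (v x y : V) : 0 ≤ openInd G v x y := by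
  rw [openInd]; positivity

lemma openInd_comm (v x y : V) : openInd G v x y = openInd G v y x := by
  grind [openInd, G.adj_comm x y]

lemma openInd_self_left (v y : V) : openInd G v v y = 0 := if_neg fun h => G.irrefl h.1

lemma openInd_self_right (v x : V) : openInd G v x x = 0 := if_neg fun h => h.2.2.1 rfl

variable [Fintype V]

/-- The number of open triplets, each counted once for each order of its endpoints. -/
noncomputable def openCount : ℝ := ∑ v, ∑ x, ∑ y, openInd G v x y

/-- The number of open triplets that contain `z`, counted as in `openCount`. -/
noncomputable def openCountAt (z : V) : ℝ :=
  ∑ x, ∑ y, openInd G z x y + 2 * ∑ v, ∑ y, openInd G v z y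

lemma openCount_nonneg : 0 ≤ openCount G :=
  Finset.sum_nonneg fun _ _ => Finset.sum_nonneg fun _ _ => Finset.sum_nonneg fun _ _ =>
    openInd_nonneg G _ _ _

lemma openCount_bot : openCount (⊥ : SimpleGraph V) = 0 := by
  simp [openCount, openInd]

end General

variable {n : ℕ}

lemma openCount_eq_sum_castSucc (H : SimpleGraph (Fin (n + 2))) : openCount H =
    ∑ v : Fin (n + 1), ∑ x : Fin (n + 1), ∑ y : Fin (n + 1),
        openInd H v.castSucc x.castSucc y.castSucc +
      ∑ x : Fin (n + 1), ∑ y : Fin (n + 1), openInd H (Fin.last _) x.castSucc y.castSucc +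
      2 * ∑ v : Fin (n + 1), ∑ y : Fin (n + 1),
        openInd H v.castSucc (Fin.last _) y.castSucc := by
  simp only [openCount, Fin.sum_univ_castSucc (n := n + 1), openInd_self_left, openInd_self_right,
    openInd_comm H _ _ (Fin.last _), Finset.sum_add_distrib, Finset.sum_const_zero]
  ring

variable (G : SimpleGraph (Fin (n + 1))) (a b v x y : Fin (n + 1))

lemma openInd_stepV1_castSucc : openInd (stepV1 G a b) v.castSucc x.castSucc y.castSucc =
    openInd G v x y - (if v = b then openInd G v x y else 0) -
      (if x = b then openInd G v x y else 0) - (if y = b then openInd G v x y else 0) := by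
  simp only [openInd, stepV1_adj_castSucc, ne_eq, Fin.castSucc_inj]
  by_cases h : G.Adj v x ∧ G.Adj v y ∧ x ≠ y ∧ ¬ G.Adj x y
  · have hvx : v ≠ x := h.1.ne
    have hvy : v ≠ y := h.2.1.ne
    have hxy : x ≠ y := h.2.2.1
    rcases eq_or_ne v b with rfl | hv
    · simp [h, hvx.symm, hvy.symm]
    rcases eq_or_ne x b with rfl | hx
    · simp [h, hvx, hxy.symm]
    rcases eq_or_ne y b with rfl | hy <;> simp [*]
  · simp only [h, if_false, ite_self, sub_zero]
    grind

-- A pair of neighbours of the new vertex is not joined only if the corresponding members of the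
-- closed neighbourhood of `a` were not joined or one of them is `b`.
lemma openInd_stepV1_last_castSucc_le :
    openInd (stepV1 G a b) (Fin.last _) x.castSucc y.castSucc ≤
      openInd G a x y + (if x = b then closedAdjMatrix G a b * closedAdjMatrix G a y else 0) +
        (if y = b then closedAdjMatrix G a b * closedAdjMatrix G a x else 0) := by
  simp only [openInd, closedAdjMatrix_apply, stepV1_adj_last, stepV1_adj_castSucc, ne_eq,
    Fin.castSucc_inj]
  grind [G.adj_comm, G.irrefl (v := x)]

lemma openInd_stepV1_castSucc_last_le :
    openInd (stepV1 G a b) v.castSucc (Fin.last _) y.castSucc ≤ openInd G v a y := by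
  simp only [openInd, (stepV1 G a b).adj_comm v.castSucc (Fin.last _), stepV1_adj_last,
    stepV1_adj_castSucc]
  grind [G.adj_comm]

lemma openCount_stepV1_le : openCount (stepV1 G a b) ≤ openCount G - openCountAt G b +
    openCountAt G a + 2 * (closedAdjMatrix G a b * (G.degree a + 1)) := by
  have hold : ∑ v : Fin (n + 1), ∑ x : Fin (n + 1), ∑ y : Fin (n + 1),
      openInd (stepV1 G a b) v.castSucc x.castSucc y.castSucc =
        openCount G - openCountAt G b := by
    have hx : ∑ v, ∑ x, ∑ y, (if x = b then openInd G v x y else 0) = ∑ v, ∑ y, openInd G v b y :=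
      Finset.sum_congr rfl fun v _ => by
        rw [Finset.sum_eq_single b] <;> simp +contextual
    have hv : ∑ v, ∑ x, ∑ y, (if v = b then openInd G v x y else 0) =
        ∑ x, ∑ y, openInd G b x y := by
      rw [Finset.sum_eq_single b] <;> simp +contextual
    simp only [openInd_stepV1_castSucc, Finset.sum_sub_distrib, hx, hv, Finset.sum_ite_eq',
      Finset.mem_univ, if_true, openInd_comm G _ _ b, openCount, openCountAt]
    ring
  have hcentre : ∑ x : Fin (n + 1), ∑ y : Fin (n + 1),
      openInd (stepV1 G a b) (Fin.last _) x.castSucc y.castSucc ≤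
      ∑ x, ∑ y, openInd G a x y + 2 * (closedAdjMatrix G a b * (G.degree a + 1)) := by
    refine (Finset.sum_le_sum fun x _ => Finset.sum_le_sum fun y _ =>
      openInd_stepV1_last_castSucc_le G a b x y).trans_eq ?_
    have hx : ∑ x, ∑ y, (if x = b then closedAdjMatrix G a b * closedAdjMatrix G a y else 0) =
        closedAdjMatrix G a b * (G.degree a + 1) := by
      rw [Finset.sum_eq_single b] <;> simp +contextual [← Finset.mul_sum, sum_closedAdjMatrix]
    simp only [Finset.sum_add_distrib, hx, Finset.sum_ite_eq', Finset.mem_univ, if_true,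
      ← Finset.mul_sum, sum_closedAdjMatrix]
    ring
  have hend := Finset.sum_le_sum fun v (_ : v ∈ Finset.univ) =>
    Finset.sum_le_sum fun y (_ : y ∈ Finset.univ) => openInd_stepV1_castSucc_last_le G a b v y
  rw [openCount_eq_sum_castSucc, hold]
  linarith [openCountAt.eq_1 G a]

lemma expect_openCount_stepV1_le :
    𝔼 p : Fin (n + 1) × Fin (n + 1), openCount (stepV1 G p.1 p.2) ≤ openCount G +
      2 * degreeStatistic (fun k => ((k : ℝ) + 1) ^ 2) G / ((n : ℝ) + 1) ^ 2 := by
  let r (v : Fin (n + 1)) : ℝ := G.degree v + 1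
  calc 𝔼 p : Fin (n + 1) × Fin (n + 1), openCount (stepV1 G p.1 p.2)
      ≤ 𝔼 p : Fin (n + 1) × Fin (n + 1), (openCount G - openCountAt G p.2 + openCountAt G p.1 +
          2 * (closedAdjMatrix G p.1 p.2 * r p.1)) :=
        Finset.expect_le_expect fun p _ => openCount_stepV1_le G p.1 p.2
    _ = openCount G + 2 * 𝔼 a, (𝔼 b, closedAdjMatrix G a b) * r a := by
        simp only [expect_prod, Finset.expect_add_distrib, Finset.expect_sub_distrib,
          Fintype.expect_const, ← Finset.mul_expect, ← Finset.expect_mul]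
        ring
    _ = _ := by
        simp only [expect_closedAdjMatrix]
        rw [Fintype.expect_eq_sum_div_card, mul_div_assoc, degreeStatistic, Finset.sum_div,
          Finset.sum_div, Fintype.card_fin, Nat.cast_add_one]
        refine congrArg _ (congrArg _ (Finset.sum_congr rfl fun a _ => ?_))
        field_simp
        rfl

lemma expect_openCount_stepV1_div_le :
    𝔼 p : Fin (n + 1) × Fin (n + 1), openCount (stepV1 G p.1 p.2) / ((n : ℝ) + 1 + 1) ≤
      openCount G / ((n : ℝ) + 1) +
        2 * (degreeStatistic (fun k => ((k : ℝ) + 1) ^ 2) G / ((n : ℝ) + 1) ^ 3) := by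
  have hopen := openCount_nonneg G
  have hsq : 0 ≤ degreeStatistic (fun k => ((k : ℝ) + 1) ^ 2) G :=
    degreeStatistic_nonneg (fun _ => sq_nonneg _) G
  rw [← Finset.expect_div]
  calc _ ≤ (openCount G + 2 * degreeStatistic (fun k => ((k : ℝ) + 1) ^ 2) G /
          ((n : ℝ) + 1) ^ 2) / ((n : ℝ) + 1) :=
        div_le_div₀ (by positivity) (expect_openCount_stepV1_le G) (by positivity) (by linarith)
    _ = _ := by field_simp

end OpenTriplets

/-! ### Clustering coefficients -/

section Clustering

open scoped Classical

variable {V : Type*} [Fintype V] (G : SimpleGraph V)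

lemma mem_connectedTriplets {v : V} {s : Finset V} :
    ⟨v, s⟩ ∈ connectedTriplets G ↔ (∀ x ∈ s, G.Adj v x) ∧ s.card = 2 := by
  simp [connectedTriplets, Finset.mem_powersetCard, Finset.subset_iff]

/-- The connected triplets whose endpoints are joined. -/
noncomputable def closedTriplets : Finset ((_ : V) × Finset V) :=
  (connectedTriplets G).filter fun p => G.IsClique (p.2 : Set V)

lemma mem_closedTriplets {v : V} {s : Finset V} :
    ⟨v, s⟩ ∈ closedTriplets G ↔ v ∉ s ∧ G.IsNClique 3 (insert v s) := by
  rw [closedTriplets, Finset.mem_filter, mem_connectedTriplets, SimpleGraph.isNClique_iff,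
    Finset.coe_insert, SimpleGraph.isClique_insert]
  constructor
  · rintro ⟨⟨hadj, hcard⟩, hs⟩
    have hv : v ∉ s := fun h => G.irrefl (hadj v h)
    exact ⟨hv, ⟨hs, fun x hx _ => hadj x hx⟩, by rw [Finset.card_insert_of_notMem hv, hcard]⟩
  · rintro ⟨hv, ⟨hs, hadj⟩, hcard⟩
    rw [Finset.card_insert_of_notMem hv] at hcard
    exact ⟨⟨fun x hx => hadj x hx fun h => hv (h ▸ hx), by omega⟩, hs⟩

lemma card_closedTriplets : (closedTriplets G).card = 3 * (G.cliqueFinset 3).card := by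
  have hsigma : 3 * (G.cliqueFinset 3).card =
      ((G.cliqueFinset 3).sigma fun t => (t : Finset V)).card := by
    rw [Finset.card_sigma, mul_comm, ← smul_eq_mul, ← Finset.sum_const]
    exact Finset.sum_congr rfl fun t ht => (SimpleGraph.mem_cliqueFinset_iff.1 ht).card_eq.symm
  rw [hsigma]
  refine Finset.card_bij' (fun p _ => ⟨insert p.1 p.2, p.1⟩) (fun p _ => ⟨p.2, p.1.erase p.2⟩)
    ?_ ?_ ?_ ?_
  · rintro ⟨v, s⟩ h
    rw [mem_closedTriplets] at h
    exact Finset.mem_sigma.2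
      ⟨SimpleGraph.mem_cliqueFinset_iff.2 h.2, Finset.mem_insert_self _ _⟩
  · rintro ⟨t, v⟩ h
    rw [Finset.mem_sigma, SimpleGraph.mem_cliqueFinset_iff] at h
    rw [mem_closedTriplets, Finset.insert_erase h.2]
    exact ⟨Finset.notMem_erase _ _, h.1⟩
  · rintro ⟨v, s⟩ h
    simp [Finset.erase_insert ((mem_closedTriplets G).1 h).1]
  · rintro ⟨t, v⟩ h
    simp [Finset.insert_erase (Finset.mem_sigma.1 h).2]

lemma card_connectedTriplets_le :
    ((connectedTriplets G).card : ℝ) ≤ (closedTriplets G).card + openCount G := by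
  have hopen : openCount G = (Finset.univ.filter fun p : V × V × V =>
      G.Adj p.1 p.2.1 ∧ G.Adj p.1 p.2.2 ∧ p.2.1 ≠ p.2.2 ∧ ¬ G.Adj p.2.1 p.2.2).card := by
    simp only [openCount, openInd, Finset.natCast_card_filter, Fintype.sum_prod_type]
  rw [hopen, closedTriplets, ← Finset.card_filter_add_card_filter_not
    (fun p : (_ : V) × Finset V => G.IsClique (p.2 : Set V)), Nat.cast_add]
  gcongr
  refine (Finset.card_le_card ?_).trans
    (Finset.card_image_le (f := fun p : V × V × V => ⟨p.1, {p.2.1, p.2.2}⟩))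
  rintro ⟨v, s⟩ h
  obtain ⟨h, hclique⟩ := Finset.mem_filter.1 h
  obtain ⟨hadj, hcard⟩ := (mem_connectedTriplets G).1 h
  obtain ⟨x, y, hxy, rfl⟩ := Finset.card_eq_two.1 hcard
  refine Finset.mem_image.2 ⟨(v, x, y), Finset.mem_filter.2 ⟨Finset.mem_univ _,
    hadj x (by simp), hadj y (by simp), hxy, fun h => hclique ?_⟩, rfl⟩
  rw [Finset.coe_pair]
  exact SimpleGraph.isClique_pair.2 fun _ => h

lemma globalClustering_eq_card_div :
    globalClustering G = (closedTriplets G).card / (connectedTriplets G).card := by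
  rw [globalClustering, card_closedTriplets, Nat.cast_mul, Nat.cast_ofNat]

lemma globalClustering_le_one : globalClustering G ≤ 1 := by
  rw [globalClustering_eq_card_div]
  exact div_le_one_of_le₀ (Nat.cast_le.2 (Finset.card_filter_le _ _)) (Nat.cast_nonneg _)

lemma degreeCount_two_le : degreeCount G 2 ≤ (connectedTriplets G).card := by
  rw [connectedTriplets, Finset.card_sigma, degreeCount, Finset.card_filter]
  refine Finset.sum_le_sum fun v _ => ?_
  split_ifs with h
  · rw [Finset.card_powersetCard, SimpleGraph.card_neighborFinset_eq_degree, h, Nat.choose_self]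
  · exact Nat.zero_le _

lemma one_sub_le_globalClustering (h : 0 < degreeCount G 2) :
    1 - openCount G / degreeCount G 2 ≤ globalClustering G := by
  have hpos : (0 : ℝ) < degreeCount G 2 := Nat.cast_pos.2 h
  have hle : (degreeCount G 2 : ℝ) ≤ (connectedTriplets G).card :=
    Nat.cast_le.2 (degreeCount_two_le G)
  calc 1 - openCount G / degreeCount G 2
      ≤ 1 - openCount G / (connectedTriplets G).card :=
        sub_le_sub_left (div_le_div_of_nonneg_left (openCount_nonneg G) hpos hle) 1
    _ ≤ globalClustering G := by
        rw [globalClustering_eq_card_div, sub_le_iff_le_add, ← add_div,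
          le_div_iff₀ (hpos.trans_le hle), one_mul]
        exact card_connectedTriplets_le G

lemma localClustering_nonneg (v : V) : 0 ≤ localClustering G v := by
  rw [localClustering]; positivity

lemma localClustering_le (v : V) : localClustering G v ≤ if G.degree v < 2 then 0 else 1 := by
  rw [localClustering]
  split_ifs
  · rfl
  · rw [← SimpleGraph.card_neighborSet_eq_degree]
    exact div_le_one_of_le₀ (Nat.cast_le.2 SimpleGraph.card_edgeFinset_le_card_choose_two)
      (Nat.cast_nonneg _)

lemma localClustering_eq_one {v : V} (hd : 2 ≤ G.degree v)
    (h : G.IsClique (G.neighborSet v)) : localClustering G v = 1 := by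
  have htop : (G.induce (G.neighborSet v)).edgeFinset.card =
      (⊤ : SimpleGraph (G.neighborSet v)).edgeFinset.card := by
    rw [SimpleGraph.edgeFinset_card, SimpleGraph.edgeFinset_card]
    simp only [SimpleGraph.induce_eq_top.2 h]
  rw [localClustering, if_neg hd.not_gt, htop,
    SimpleGraph.card_edgeFinset_top_eq_card_choose_two, SimpleGraph.card_neighborSet_eq_degree,
    div_self (Nat.cast_ne_zero.2 (Nat.choose_pos hd).ne')]

lemma le_localClustering (v : V) : (if G.degree v < 2 then 0 else 1) -
    ∑ x, ∑ y, openInd G v x y ≤ localClustering G v := by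
  have hopen (x : V) : 0 ≤ ∑ y, openInd G v x y :=
    Finset.sum_nonneg fun y _ => openInd_nonneg G v x y
  have hsum : 0 ≤ ∑ x, ∑ y, openInd G v x y := Finset.sum_nonneg fun x _ => hopen x
  have hlocal := localClustering_nonneg G v
  split_ifs with hd
  · linarith
  by_cases h : G.IsClique (G.neighborSet v)
  · rw [localClustering_eq_one G (not_lt.1 hd) h]
    linarith
  · obtain ⟨x, hx, y, hy, hxy, hadj⟩ : ∃ x, G.Adj v x ∧ ∃ y, G.Adj v y ∧ x ≠ y ∧ ¬ G.Adj x y := by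
      simpa [SimpleGraph.IsClique, Set.Pairwise] using h
    have hone : 1 ≤ ∑ x, ∑ y, openInd G v x y :=
      calc 1 = openInd G v x y := (if_pos ⟨hx, hy, hxy, hadj⟩).symm
        _ ≤ ∑ y, openInd G v x y :=
          Finset.single_le_sum (fun y _ => openInd_nonneg G v x y) (Finset.mem_univ y)
        _ ≤ _ := Finset.single_le_sum (fun x _ => hopen x) (Finset.mem_univ x)
    linarith

lemma sum_ite_degree_lt_two : ∑ v, (if G.degree v < 2 then (0 : ℝ) else 1) =
    Fintype.card V - degreeCount G 0 - degreeCount G 1 := by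
  rw [degreeCount_eq_degreeStatistic, degreeCount_eq_degreeStatistic, ← Finset.card_univ,
    Finset.cast_card, degreeStatistic, degreeStatistic, ← Finset.sum_sub_distrib,
    ← Finset.sum_sub_distrib]
  refine Finset.sum_congr rfl fun v _ => ?_
  rcases G.degree v with _ | _ | k <;> simp

lemma abs_averageClustering_sub_le [Nonempty V] :
    |averageClustering G - (1 - (degreeCount G 0 : ℝ) / Fintype.card V -
      (degreeCount G 1 : ℝ) / Fintype.card V)| ≤ openCount G / Fintype.card V := by
  have hcard : (0 : ℝ) < Fintype.card V := Nat.cast_pos.2 Fintype.card_pos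
  have hle := Finset.sum_le_sum fun v (_ : v ∈ Finset.univ) => localClustering_le G v
  have hge := Finset.sum_le_sum fun v (_ : v ∈ Finset.univ) => le_localClustering G v
  rw [sum_ite_degree_lt_two] at hle
  rw [Finset.sum_sub_distrib, sum_ite_degree_lt_two] at hge
  have hdiff : averageClustering G - (1 - (degreeCount G 0 : ℝ) / Fintype.card V -
      (degreeCount G 1 : ℝ) / Fintype.card V) = (∑ v, localClustering G v -
      (Fintype.card V - degreeCount G 0 - degreeCount G 1)) / Fintype.card V := by
    rw [averageClustering]; field_simp
  rw [hdiff, abs_div, abs_of_pos hcard]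
  gcongr
  rw [abs_le]
  constructor <;> linarith [openCount_nonneg G, openCount.eq_1 G]

end Clustering

/-! ### Moments of the random graph -/

section Selection

variable {Ω : Type*} {A B : (n : ℕ) → Ω → Fin (n + 1)}

/-- The pair of vertices selected in the step leading from `n + 1` to `n + 2` vertices. -/
def selectedPair (A B : (n : ℕ) → Ω → Fin (n + 1)) (n : ℕ) (ω : Ω) : Fin (n + 1) × Fin (n + 1) :=
  (A n ω, B n ω)

/-- The random graph after `n` steps. -/
def randomGraph (A B : (n : ℕ) → Ω → Fin (n + 1)) (n : ℕ) (ω : Ω) : SimpleGraph (Fin (n + 1)) :=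
  graphV1 (fun k => A k ω) (fun k => B k ω) n

lemma randomGraph_succ (n : ℕ) (ω : Ω) : randomGraph A B (n + 1) ω =
    stepV1 (randomGraph A B n ω) (selectedPair A B n ω).1 (selectedPair A B n ω).2 := rfl

lemma randomGraph_zero (ω : Ω) : randomGraph A B 0 ω = ⊥ := rfl

variable [mΩ : MeasurableSpace Ω] {μ : Measure Ω}

instance measurableSingletonClass_simpleGraph {V : Type*} [Countable V] :
    MeasurableSingletonClass (SimpleGraph V) where
  measurableSet_singleton G :=
    ⟨{G.Adj}, MeasurableSet.singleton _, by ext H; simp⟩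

namespace IsUniformSelection

lemma measurable_selectedPair (h : IsUniformSelection μ A B) (n : ℕ) :
    Measurable (selectedPair A B n) :=
  (h.measurable_fst n).prodMk (h.measurable_snd n)

/-- The filtration whose `n`-th term is generated by the selections of the first `n` steps. -/
def past (h : IsUniformSelection μ A B) : Filtration ℕ mΩ where
  seq n := ⨆ k ∈ Set.Iio n, MeasurableSpace.comap (selectedPair A B k) inferInstance
  mono' _ _ hmn := biSup_mono fun _ hk => lt_of_lt_of_le hk hmn
  le' _ := iSup₂_le fun k _ => (h.measurable_selectedPair k).comap_le

lemma measurable_selectedPair_past (h : IsUniformSelection μ A B) (n : ℕ) :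
    Measurable[h.past (n + 1)] (selectedPair A B n) :=
  measurable_iff_comap_le.2 <|
    le_biSup (fun k => MeasurableSpace.comap (selectedPair A B k) inferInstance)
      (Set.mem_Iio.2 n.lt_succ_self)

lemma measurable_randomGraph (h : IsUniformSelection μ A B) (n : ℕ) :
    Measurable[h.past n] (randomGraph A B n) := by
  induction n with
  | zero => exact @measurable_const _ _ _ (h.past 0) ⊥
  | succ n ih =>
    have hstep : Measurable fun q : SimpleGraph (Fin (n + 1)) × Fin (n + 1) × Fin (n + 1) =>
      stepV1 q.1 q.2.1 q.2.2 := .of_discrete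
    have hpair := (ih.mono (h.past.mono n.le_succ) le_rfl).prodMk (h.measurable_selectedPair_past n)
    exact Measurable.comp hstep hpair

section

variable {n : ℕ} (φ : SimpleGraph (Fin (n + 1)) → ℝ)
  (f : SimpleGraph (Fin (n + 1)) → Fin (n + 1) × Fin (n + 1) → ℝ)

lemma stronglyMeasurable_comp (h : IsUniformSelection μ A B) :
    StronglyMeasurable[h.past n] fun ω => φ (randomGraph A B n ω) := by
  have hφ : Measurable φ := .of_discrete
  exact Measurable.stronglyMeasurable (hφ.comp (h.measurable_randomGraph n))

lemma stronglyMeasurable_step (h : IsUniformSelection μ A B) :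
    StronglyMeasurable[h.past (n + 1)] fun ω => f (randomGraph A B n ω) (selectedPair A B n ω) :=
  ((Measurable.of_discrete (f := fun q : SimpleGraph (Fin (n + 1)) × _ => f q.1 q.2)).comp
    (((h.measurable_randomGraph n).mono (h.past.mono n.le_succ) le_rfl).prodMk
      (h.measurable_selectedPair_past n))).stronglyMeasurable

lemma indep_past (h : IsUniformSelection μ A B) (n : ℕ) :
    Indep (MeasurableSpace.comap (selectedPair A B n) inferInstance) (h.past n) μ := by
  have hindep := indep_iSup_of_disjoint (fun k => (h.measurable_selectedPair k).comap_le)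
    h.indep_steps.iIndep (S := {n}) (T := Set.Iio n) (by simp)
  rwa [iSup_singleton] at hindep

lemma measureReal_selectedPair (h : IsUniformSelection μ A B) (p : Fin (n + 1) × Fin (n + 1)) :
    μ.real (selectedPair A B n ⁻¹' {p}) = (Fintype.card (Fin (n + 1) × Fin (n + 1)) : ℝ)⁻¹ := by
  have hinter : selectedPair A B n ⁻¹' {p} = A n ⁻¹' {p.1} ∩ B n ⁻¹' {p.2} := by
    ext; simp [selectedPair, Prod.ext_iff]
  rw [hinter, measureReal_def, (h.indep_pair n).measure_inter_preimage_eq_mul _ _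
    (measurableSet_singleton _) (measurableSet_singleton _), h.uniform_fst, h.uniform_snd,
    Fintype.card_prod, Fintype.card_fin, Nat.cast_mul, mul_inv, ENNReal.toReal_mul,
    ENNReal.toReal_inv, ENNReal.toReal_add (ENNReal.natCast_ne_top n) ENNReal.one_ne_top]
  simp

variable [IsProbabilityMeasure μ]

lemma memLp_step (h : IsUniformSelection μ A B) (q : ENNReal) :
    MemLp (fun ω => f (randomGraph A B n ω) (selectedPair A B n ω)) q μ := by
  obtain ⟨K, hK⟩ := (Set.finite_range fun p : SimpleGraph (Fin (n + 1)) × _ =>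
    ‖f p.1 p.2‖).bddAbove
  exact MemLp.of_bound ((h.stronglyMeasurable_step f).mono (h.past.le _)).aestronglyMeasurable
    K (ae_of_all _ fun ω => hK ⟨(_, _), rfl⟩)

lemma integrable_step (h : IsUniformSelection μ A B) :
    Integrable (fun ω => f (randomGraph A B n ω) (selectedPair A B n ω)) μ :=
  memLp_one_iff_integrable.1 (h.memLp_step f 1)

lemma integrable_comp (h : IsUniformSelection μ A B) :
    Integrable (fun ω => φ (randomGraph A B n ω)) μ :=
  h.integrable_step fun G _ => φ G

lemma condExp_step (h : IsUniformSelection μ A B) :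
    μ[fun ω => f (randomGraph A B n ω) (selectedPair A B n ω) | h.past n] =ᵐ[μ]
      fun ω => 𝔼 p, f (randomGraph A B n ω) p := by
  filter_upwards [condExp_comp_of_indep (h.measurable_selectedPair n) (h.past.le n)
    (h.indep_past n) (fun p => h.stronglyMeasurable_comp fun G => f G p)
    fun p => h.integrable_comp fun G => f G p] with ω hω
  simp only [hω, h.measureReal_selectedPair, ← Finset.mul_sum, Fintype.expect_eq_sum_div_card,
    div_eq_inv_mul]

lemma integral_step (h : IsUniformSelection μ A B) :
    ∫ ω, f (randomGraph A B n ω) (selectedPair A B n ω) ∂μ =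
      ∫ ω, 𝔼 p, f (randomGraph A B n ω) p ∂μ := by
  rw [← integral_condExp (h.past.le n), integral_congr_ae (h.condExp_step f)]

variable {φ f} in
lemma integral_step_le (h : IsUniformSelection μ A B) (hfφ : ∀ G, 𝔼 p, f G p ≤ φ G) :
    ∫ ω, f (randomGraph A B n ω) (selectedPair A B n ω) ∂μ ≤ ∫ ω, φ (randomGraph A B n ω) ∂μ := by
  rw [h.integral_step]
  exact integral_mono (h.integrable_comp fun G => 𝔼 p, f G p) (h.integrable_comp φ) fun ω => hfφ _

end

section Moments

variable [IsProbabilityMeasure μ] (h : IsUniformSelection μ A B) (n : ℕ)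
include h

lemma integral_degreeStatistic_succ_le {f : ℕ → ℝ} (hf : Monotone fun k => f (k + 1) - f k) :
    ∫ ω, degreeStatistic f (randomGraph A B (n + 1) ω) ∂μ ≤
      ∫ ω, degreeStatistic f (randomGraph A B n ω) ∂μ +
        (∫ ω, degreeStatistic (birthDeathGenerator f) (randomGraph A B n ω) ∂μ) / (n + 1) +
        f 0 := by
  refine (h.integral_step_le fun G => expect_degreeStatistic_stepV1_le f hf G).trans_eq ?_
  have hf' := h.integrable_comp (n := n) fun G => degreeStatistic f G
  have hgen := h.integrable_comp (n := n) fun G =>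
    degreeStatistic (birthDeathGenerator f) G / ((n : ℝ) + 1)
  rw [integral_add (by exact hf'.add hgen) (integrable_const _), integral_add hf' hgen,
    integral_div, integral_const, probReal_univ, one_smul]

lemma integral_degreeStatistic_add_one_le :
    ∫ ω, degreeStatistic (fun k => (k : ℝ) + 1) (randomGraph A B n ω) ∂μ ≤ 3 * n + 1 := by
  induction n with
  | zero => simp [randomGraph_zero, degreeStatistic_bot]
  | succ n ih =>
    have hconst (ω : Ω) : degreeStatistic (2 : ℕ → ℝ) (randomGraph A B n ω) = 2 * (n + 1) := by
      simp [degreeStatistic, mul_comm]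
    have hstep := h.integral_degreeStatistic_succ_le n (f := fun k => (k : ℝ) + 1) (by
      simpa using monotone_const)
    simp only [birthDeathGenerator_add_one, hconst, integral_const, probReal_univ,
      one_smul] at hstep
    rw [mul_div_cancel_right₀ _ n.cast_add_one_ne_zero] at hstep
    push_cast at hstep ⊢
    linarith

lemma integral_degreeStatistic_add_one_sq_le :
    ∫ ω, degreeStatistic (fun k => ((k : ℝ) + 1) ^ 2) (randomGraph A B n ω) ∂μ ≤ 19 * n + 1 := by
  induction n with
  | zero => simp [randomGraph_zero, degreeStatistic_bot]
  | succ n ih =>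
    have hgen (ω : Ω) : degreeStatistic (fun k : ℕ => 6 * ((k : ℝ) + 1)) (randomGraph A B n ω) =
        6 * degreeStatistic (fun k => (k : ℝ) + 1) (randomGraph A B n ω) := by
      simp only [degreeStatistic, Finset.mul_sum]
    have hstep := h.integral_degreeStatistic_succ_le n (f := fun k => ((k : ℝ) + 1) ^ 2)
      (monotone_nat_of_le_succ fun k => by push_cast; linarith)
    rw [birthDeathGenerator_add_one_sq] at hstep
    simp only [hgen, integral_const_mul] at hstep
    have hdrift : (6 * ∫ ω, degreeStatistic (fun k => (k : ℝ) + 1) (randomGraph A B n ω) ∂μ) /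
        (n + 1) ≤ 18 := by
      rw [div_le_iff₀ (by positivity)]
      linarith [h.integral_degreeStatistic_add_one_le n]
    push_cast at hstep ⊢
    linarith

lemma summable_integral_degreeStatistic_add_one_sq_div : Summable fun n : ℕ => ∫ ω,
    degreeStatistic (fun k => ((k : ℝ) + 1) ^ 2) (randomGraph A B n ω) / ((n : ℝ) + 1) ^ 3 ∂μ := by
  have hs : Summable fun n : ℕ => 19 * (1 / ((n : ℝ) + 1) ^ 2) := by
    have := ((summable_nat_add_iff 1).2 (Real.summable_one_div_nat_pow.2 one_lt_two)).mul_left 19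
    simpa only [Nat.cast_add_one] using this
  refine Summable.of_nonneg_of_le (fun n => integral_nonneg fun ω => ?_) (fun n => ?_) hs
  · exact div_nonneg (degreeStatistic_nonneg (fun _ => sq_nonneg _) _) (by positivity)
  · rw [integral_div, div_le_iff₀ (by positivity)]
    refine (h.integral_degreeStatistic_add_one_sq_le n).trans ?_
    field_simp
    linarith

lemma integral_openCount_le :
    ∫ ω, openCount (randomGraph A B n ω) ∂μ ≤ ∑ k ∈ Finset.range n, 38 * (1 / ((k : ℝ) + 1)) := by
  induction n with
  | zero => simp [randomGraph_zero, openCount_bot]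
  | succ n ih =>
    have hstep : ∫ ω, openCount (randomGraph A B (n + 1) ω) ∂μ ≤ _ :=
      h.integral_step_le (n := n) expect_openCount_stepV1_le
    have hS : Integrable (fun ω => 2 * degreeStatistic (fun k => ((k : ℝ) + 1) ^ 2)
        (randomGraph A B n ω) / ((n : ℝ) + 1) ^ 2) μ :=
      ((h.integrable_comp fun G => degreeStatistic _ G).const_mul 2).div_const _
    rw [integral_add (h.integrable_comp (n := n) fun G => openCount G) hS, integral_div,
      integral_const_mul] at hstep
    rw [Finset.sum_range_succ]
    refine hstep.trans (add_le_add ih ?_)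
    rw [div_le_iff₀ (by positivity)]
    have := h.integral_degreeStatistic_add_one_sq_le n
    field_simp
    linarith

omit n

lemma tendsto_integral_openCount_div :
    Tendsto (fun n : ℕ => ∫ ω, openCount (randomGraph A B n ω) / ((n : ℝ) + 1) ∂μ) atTop (𝓝 0) := by
  have hcesaro : Tendsto (fun n : ℕ => (n : ℝ)⁻¹ * ∑ k ∈ Finset.range n, 38 * (1 / ((k : ℝ) + 1)))
      atTop (𝓝 0) := by
    simpa using (tendsto_one_div_add_atTop_nhds_zero_nat.const_mul (38 : ℝ)).cesaro
  refine squeeze_zero' (.of_forall fun n => integral_nonneg fun ω => ?_) ?_ hcesaro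
  · exact div_nonneg (openCount_nonneg _) (by positivity)
  · filter_upwards [eventually_gt_atTop 0] with n hn
    rw [integral_div, div_eq_inv_mul]
    exact mul_le_mul (inv_anti₀ (by positivity) (by linarith)) (h.integral_openCount_le n)
      (integral_nonneg fun ω => openCount_nonneg _) (by positivity)

lemma ae_tendsto_openCount_div : ∀ᵐ ω ∂μ,
    Tendsto (fun n : ℕ => openCount (randomGraph A B n ω) / ((n : ℝ) + 1)) atTop (𝓝 0) := by
  set S : (n : ℕ) → SimpleGraph (Fin (n + 1)) → ℝ := fun n => degreeStatistic fun k => (k + 1) ^ 2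
  refine ae_tendsto_zero_of_almost_supermartingale (F := h.past)
    (e := fun n ω => 2 * (S n (randomGraph A B n ω) / ((n : ℝ) + 1) ^ 3))
    (fun n => h.stronglyMeasurable_comp fun G => openCount G / ((n : ℝ) + 1))
    (fun n => h.stronglyMeasurable_comp fun G => 2 * (S n G / ((n : ℝ) + 1) ^ 3))
    (fun n => h.integrable_comp fun G => openCount G / ((n : ℝ) + 1))
    (fun n => h.integrable_comp fun G => 2 * (S n G / ((n : ℝ) + 1) ^ 3))
    (fun n ω => div_nonneg (openCount_nonneg _) (by positivity)) (fun n ω => ?_) (fun n => ?_) ?_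
    h.tendsto_integral_openCount_div
  · exact mul_nonneg zero_le_two
      (div_nonneg (degreeStatistic_nonneg (fun _ => sq_nonneg _) _) (by positivity))
  · filter_upwards [h.condExp_step (n := n) fun G p =>
      openCount (stepV1 G p.1 p.2) / ((n : ℝ) + 1 + 1)] with ω hω
    rw [Nat.cast_add_one]
    exact hω.trans_le (expect_openCount_stepV1_div_le _)
  · simpa only [integral_const_mul] using
      h.summable_integral_degreeStatistic_add_one_sq_div.mul_left 2

end Moments

end IsUniformSelection

end Selection

/-! ### Almost sure limits -/

section CenteredIncrement

variable (f : ℕ → ℝ) {V : Type*} [Fintype V]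

lemma expect_sub_expect_sq_le {ι : Type*} [Fintype ι] [Nonempty ι] (g : ι → ℝ) :
    𝔼 i, (g i - 𝔼 j, g j) ^ 2 ≤ 𝔼 i, g i ^ 2 := by
  have hexp : 𝔼 i, (g i - 𝔼 j, g j) ^ 2 = 𝔼 i, g i ^ 2 - (𝔼 j, g j) ^ 2 := by
    simp only [sub_sq, Finset.expect_add_distrib, Finset.expect_sub_distrib, ← Finset.mul_expect,
      ← Finset.expect_mul, Fintype.expect_const]
    ring
  exact hexp.trans_le (sub_le_self _ (sq_nonneg _))

/-- The martingale difference part of the increment of `degreeStatistic f` in one step. -/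
noncomputable def centeredIncrement (G : SimpleGraph V) (p : V × V) : ℝ :=
  linearIncrement f G p - 𝔼 q, linearIncrement f G q

variable [Nonempty V] (G : SimpleGraph V)

lemma expect_centeredIncrement : 𝔼 p, centeredIncrement f G p = 0 := by
  simp only [centeredIncrement, Finset.expect_sub_distrib, Fintype.expect_const, sub_self]

lemma expect_centeredIncrement_sq_le (hf : ∀ k, f k ∈ Set.Icc 0 1) :
    𝔼 p, centeredIncrement f G p ^ 2 ≤
      9 * degreeStatistic (fun k => ((k : ℝ) + 1) ^ 2) G / Fintype.card V :=
  (expect_sub_expect_sq_le _).trans (expect_linearIncrement_sq_le f G hf)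

variable {n : ℕ} (G : SimpleGraph (Fin (n + 1))) (p : Fin (n + 1) × Fin (n + 1))

lemma degreeStatistic_stepV1_eq_add_centeredIncrement :
    degreeStatistic f (stepV1 G p.1 p.2) = degreeStatistic f G +
      (degreeStatistic (birthDeathGenerator f) G / (n + 1) + f 0) +
      (centeredIncrement f G p - interaction f G p) := by
  rw [degreeStatistic_stepV1, centeredIncrement, expect_linearIncrement, Fintype.card_fin,
    Nat.cast_add_one]
  ring

lemma degreeFraction_stepV1 (d : ℕ) :
    (degreeCount (stepV1 G p.1 p.2) d : ℝ) / ((n : ℝ) + 1 + 1) =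
      degreeCount G d / ((n : ℝ) + 1) + 1 / ((n : ℝ) + 2) * ((if d = 0 then 1 else 0) +
        (d + 1) * dirichletLaplacian (fun j => degreeCount G j / ((n : ℝ) + 1)) d -
        degreeCount G d / ((n : ℝ) + 1)) +
      (centeredIncrement (fun k => if k = d then 1 else 0) G p -
        interaction (fun k => if k = d then 1 else 0) G p) / ((n : ℝ) + 2) := by
  have hΔ : dirichletLaplacian (fun j => degreeCount G j / ((n : ℝ) + 1)) =
      ((n : ℝ) + 1)⁻¹ • dirichletLaplacian fun j => (degreeCount G j : ℝ) := by
    rw [← map_smul]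
    simp only [div_eq_inv_mul]
    rfl
  have hn : (n : ℝ) + 1 + 1 = n + 2 := by ring
  rw [degreeCount_eq_degreeStatistic, degreeStatistic_stepV1_eq_add_centeredIncrement,
    degreeStatistic_birthDeathGenerator_ite, ← degreeCount_eq_degreeStatistic, hΔ, Pi.smul_apply,
    smul_eq_mul, hn]
  simp only [@eq_comm _ 0 d]
  field_simp
  ring

lemma degreeFraction_mem_Icc (d : ℕ) : (degreeCount G d : ℝ) / ((n : ℝ) + 1) ∈ Set.Icc 0 1 := by
  have hle : (degreeCount G d : ℝ) ≤ (n : ℝ) + 1 := by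
    exact_mod_cast (Finset.card_filter_le _ _).trans_eq (Finset.card_fin _)
  exact ⟨by positivity, div_le_one_of_le₀ hle (by positivity)⟩

end CenteredIncrement

lemma tendsto_sum_range_one_div_add_two :
    Tendsto (fun n : ℕ => ∑ k ∈ Finset.range n, 1 / ((k : ℝ) + 2)) atTop atTop := by
  have hharm := (tendsto_add_atTop_iff_nat 1).2 Real.tendsto_sum_range_one_div_nat_succ_atTop
  refine (tendsto_atTop_add_const_right _ (-1) hharm).congr fun n => ?_
  rw [Finset.sum_range_succ']
  push_cast
  simp [add_assoc, one_add_one_eq_two]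

section Limit

variable {Ω : Type*} {A B : (n : ℕ) → Ω → Fin (n + 1)} [MeasurableSpace Ω] {μ : Measure Ω}
  [IsProbabilityMeasure μ] (h : IsUniformSelection μ A B)

namespace IsUniformSelection

section Bounded

variable {f : ℕ → ℝ} (hf : ∀ k, f k ∈ Set.Icc 0 1)
include h hf

lemma ae_exists_tendsto_sum_centeredIncrement : ∀ᵐ ω ∂μ, ∃ l, Tendsto (fun n : ℕ =>
    ∑ k ∈ Finset.range n, centeredIncrement f (randomGraph A B k ω) (selectedPair A B k ω) /
      ((k : ℝ) + 2)) atTop (𝓝 l) := by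
  refine ae_exists_tendsto_sum_martingaleDifference (F := h.past)
    (ζ := fun n ω =>
      centeredIncrement f (randomGraph A B n ω) (selectedPair A B n ω) / ((n : ℝ) + 2))
    (fun n => h.stronglyMeasurable_step fun G p => centeredIncrement f G p / ((n : ℝ) + 2))
    (fun n => h.memLp_step (fun G p => centeredIncrement f G p / ((n : ℝ) + 2)) 2)
    (fun n => ?_) ?_
  · filter_upwards [h.condExp_step (n := n) fun G p => centeredIncrement f G p / ((n : ℝ) + 2)]
      with ω hω
    rw [hω, ← Finset.expect_div, expect_centeredIncrement, zero_div, Pi.zero_apply]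
  · refine Summable.of_nonneg_of_le (fun n => integral_nonneg fun ω => sq_nonneg _) (fun n => ?_)
      (h.summable_integral_degreeStatistic_add_one_sq_div.mul_left 9)
    rw [← integral_const_mul]
    refine h.integral_step_le (f := fun G p => (centeredIncrement f G p / ((n : ℝ) + 2)) ^ 2)
      (φ := fun G => 9 * (_ / _)) fun G => ?_
    have hsq := expect_centeredIncrement_sq_le f G hf
    rw [Fintype.card_fin, Nat.cast_add_one] at hsq
    have hpos : 0 ≤ degreeStatistic (fun k => ((k : ℝ) + 1) ^ 2) G :=
      degreeStatistic_nonneg (fun _ => sq_nonneg _) G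
    simp only [div_pow, ← Finset.expect_div]
    calc _ ≤ 9 * degreeStatistic (fun k => ((k : ℝ) + 1) ^ 2) G / ((n : ℝ) + 1) /
          ((n : ℝ) + 1) ^ 2 := by gcongr; linarith
      _ = _ := by field_simp

lemma ae_summable_abs_interaction : ∀ᵐ ω ∂μ, Summable fun n : ℕ =>
    |interaction f (randomGraph A B n ω) (selectedPair A B n ω)| / ((n : ℝ) + 2) := by
  refine ae_summable_of_summable_integral
    (fun n => h.integrable_step fun G p => |interaction f G p| / ((n : ℝ) + 2))
    (fun n ω => by positivity) ?_
  refine Summable.of_nonneg_of_le (fun n => integral_nonneg fun ω => by positivity) (fun n => ?_)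
    (h.summable_integral_degreeStatistic_add_one_sq_div.mul_left 2)
  rw [← integral_const_mul]
  refine h.integral_step_le (f := fun G p => |interaction f G p| / ((n : ℝ) + 2))
    (φ := fun G => 2 * (_ / _)) fun G => ?_
  have habs := expect_abs_interaction_le f G hf
  rw [Fintype.card_fin, Nat.cast_add_one] at habs
  have hpos : 0 ≤ degreeStatistic (fun k => ((k : ℝ) + 1) ^ 2) G :=
    degreeStatistic_nonneg (fun _ => sq_nonneg _) G
  rw [← Finset.expect_div]
  calc _ ≤ 2 * degreeStatistic (fun k => ((k : ℝ) + 1) ^ 2) G / ((n : ℝ) + 1) ^ 2 /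
        ((n : ℝ) + 1) := by gcongr; linarith
    _ = _ := by field_simp

lemma ae_exists_tendsto_sum_error : ∀ᵐ ω ∂μ, ∃ l, Tendsto (fun n : ℕ =>
    ∑ k ∈ Finset.range n, (centeredIncrement f (randomGraph A B k ω) (selectedPair A B k ω) -
      interaction f (randomGraph A B k ω) (selectedPair A B k ω)) / ((k : ℝ) + 2))
    atTop (𝓝 l) := by
  filter_upwards [h.ae_exists_tendsto_sum_centeredIncrement hf, h.ae_summable_abs_interaction hf]
    with ω ⟨l, hl⟩ hsum
  have hsum' : Summable fun k : ℕ =>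
      interaction f (randomGraph A B k ω) (selectedPair A B k ω) / ((k : ℝ) + 2) :=
    .of_norm <| hsum.congr fun k => by
      rw [norm_div, Real.norm_eq_abs, Real.norm_of_nonneg (by positivity : (0 : ℝ) ≤ k + 2)]
  refine ⟨_, (hl.sub hsum'.hasSum.tendsto_sum_nat).congr fun n => ?_⟩
  simp only [sub_div, Finset.sum_sub_distrib]

end Bounded

include h

theorem ae_tendsto_degreeCount_div : ∀ᵐ ω ∂μ, ∀ d, Tendsto (fun n : ℕ =>
    (degreeCount (randomGraph A B n ω) d : ℝ) / ((n : ℝ) + 1)) atTop (𝓝 (limitDegree d)) := by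
  have herror := ae_all_iff.2 fun d : ℕ => h.ae_exists_tendsto_sum_error
    (f := fun k => if k = d then 1 else 0) fun k => by split_ifs <;> simp
  filter_upwards [herror] with ω hω d
  have hs : Tendsto (fun n : ℕ => 1 / ((n : ℝ) + 2)) atTop (𝓝 0) :=
    ((tendsto_add_atTop_iff_nat 1).2 tendsto_one_div_add_atTop_nhds_zero_nat).congr fun n => by
      push_cast; ring
  refine tendsto_sub_nhds_zero_iff.1 <| tendsto_zero_of_laplacian_recursion
    (y := fun n d => degreeCount (randomGraph A B n ω) d / ((n : ℝ) + 1) - limitDegree d)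
    (K := 1) (fun n => by positivity) hs tendsto_sum_range_one_div_add_two
    (fun d => Nat.cast_add_one_pos d) (fun n d => ?_) hω (fun n d => ?_) d
  · exact Real.dist_le_of_mem_Icc_01 (degreeFraction_mem_Icc _ d)
      ⟨(limitDegree_pos d).le, limitDegree_le_one d⟩
  · have hΔ : dirichletLaplacian (fun d =>
        degreeCount (randomGraph A B n ω) d / ((n : ℝ) + 1) - limitDegree d) = _ :=
      map_sub dirichletLaplacian _ _
    have hL := limitDegree_eq_ite_add_dirichletLaplacian d
    rw [hΔ, Pi.sub_apply, randomGraph_succ, Nat.cast_add_one, degreeFraction_stepV1]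
    linear_combination -(1 / ((n : ℝ) + 2)) * hL

theorem ae_tendsto_globalClustering :
    ∀ᵐ ω ∂μ, Tendsto (fun n => globalClustering (randomGraph A B n ω)) atTop (𝓝 1) := by
  filter_upwards [h.ae_tendsto_degreeCount_div, h.ae_tendsto_openCount_div] with ω hdeg hopen
  have hlim : Tendsto (fun n => 1 - openCount (randomGraph A B n ω) /
      degreeCount (randomGraph A B n ω) 2) atTop (𝓝 1) := by
    have hquot := (hopen.div (hdeg 2) (limitDegree_pos 2).ne').const_sub 1
    rw [zero_div, sub_zero] at hquot
    exact hquot.congr fun n => by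
      rw [Pi.div_apply, div_div_div_cancel_right₀ n.cast_add_one_ne_zero]
  refine tendsto_of_tendsto_of_tendsto_of_le_of_le' hlim tendsto_const_nhds ?_
    (.of_forall fun n => globalClustering_le_one _)
  filter_upwards [(hdeg 2).eventually_const_lt (limitDegree_pos 2)] with n hn
  exact one_sub_le_globalClustering _ <|
    Nat.cast_pos.1 ((div_pos_iff_of_pos_right (by positivity)).1 hn)

theorem ae_tendsto_averageClustering : ∀ᵐ ω ∂μ,
    Tendsto (fun n => averageClustering (randomGraph A B n ω)) atTop
      (𝓝 (1 - limitDegree 0 - limitDegree 1)) := by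
  filter_upwards [h.ae_tendsto_degreeCount_div, h.ae_tendsto_openCount_div] with ω hdeg hopen
  refine tendsto_of_tendsto_of_dist (((hdeg 0).const_sub 1).sub (hdeg 1)) ?_
  refine squeeze_zero (fun n => dist_nonneg) (fun n => ?_) hopen
  rw [dist_comm, Real.dist_eq]
  simpa using abs_averageClustering_sub_le (randomGraph A B n ω)

end IsUniformSelection

end Limit

theorem theorem4 :
    ∃ c : ℕ → ℝ,
      (∀ d, 0 < c d) ∧
      c 0 = (1 + c 1) / 3 ∧
      (∀ d : ℕ, 1 ≤ d → c d = ((d : ℝ) + 1) / (2 * (d : ℝ) + 3) * (c (d - 1) + c (d + 1))) ∧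
      ∀ {Ω : Type*} [MeasurableSpace Ω] (μ : Measure Ω) [IsProbabilityMeasure μ]
        (A B : (n : ℕ) → Ω → Fin (n + 1)), IsUniformSelection μ A B →
        (∀ d : ℕ, ∀ᵐ ω ∂μ, Tendsto
          (fun n : ℕ =>
            (degreeCount (graphV1 (fun k => A k ω) (fun k => B k ω) n) d : ℝ) / ((n : ℝ) + 1))
          atTop (𝓝 (c d))) ∧
        (∀ᵐ ω ∂μ, Tendsto
          (fun n : ℕ => globalClustering (graphV1 (fun k => A k ω) (fun k => B k ω) n))
          atTop (𝓝 1)) ∧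
        (∀ᵐ ω ∂μ, Tendsto
          (fun n : ℕ => averageClustering (graphV1 (fun k => A k ω) (fun k => B k ω) n))
          atTop (𝓝 (1 - c 0 - c 1))) := by
  refine ⟨limitDegree, limitDegree_pos, limitDegree_zero, fun d hd => limitDegree_eq_mul_add hd,
    fun μ _ A B h => ⟨fun d => ?_, h.ae_tendsto_globalClustering, h.ae_tendsto_averageClustering⟩⟩
  filter_upwards [h.ae_tendsto_degreeCount_div] with ω hω
  exact hω d
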